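/- Let $\Bbbk$ be a field. A set of parameters $\chi$ consists of invertible elements $\beta_n$ ($n\in\mathbb Z$), $c_n^+$ ($n\ge 0$), $c_n^-$ ($n\le 0$) of $\Bbbk$, and it is assumed to satisfy $$-c_0^+c_0^-\beta_0=1,\qquad c_{-1}^-=\frac1{c_1^+},\qquad c_{n-2}^-=-\beta_nc_n^-\ (n\le 0),\qquad c_{n+2}^+=-\beta_nc_n^+\ (n\ge 0).$$ **The 2-category $\mathcal U_\chi$.** Its objects are the integers. Write $\mathcal E_+=\mathcal E$, $\mathcal E_-=\mathcal F$. The 1-morphisms $n\to n'$ are the formal finite direct sums of $\mathcal E_\epsilon\mathbf 1_n\{t\}$, where $t\in\mathbb Z$ and $\epsilon=(\epsilon_1,\dots,\epsilon_m)$ is a signed sequence with $n'=n+2\sum_i\epsilon_i$; composition is $\mathcal E_{\epsilon'}\mathbf 1_{n'}\{t'\}\circ\mathcal E_\epsilon\mathbf 1_n\{t\}=\mathcal E_{\epsilon'\epsilon}\mathbf 1_n\{t+t'\}$. The 2-morphisms $\mathcal E_\epsilon\mathbf 1_n\{t\}\to\mathcal E_{\epsilon'}\mathbf 1_n\{t'\}$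 are the $\Bbbk$-linear combinations of string diagrams of degree $t-t'$ modulo the relations below (and between direct sums, matrices of such). Diagrams are built by horizontal and vertical composition, in the free strict 2-category, from identities and, for each label $n$ of the rightmost region, the generators: dots on $\mathcal E$ and on $\mathcal F$ (degree $2$); crossings $\mathcal{EE}\to\mathcal{EE}$ and $\mathcal{FF}\to\mathcal{FF}$ (degree $-2$); the cup $\mathbf 1_n\to\mathcal{FE}\mathbf 1_n$ and the cap $\mathcal{FE}\mathbf 1_n\to\mathbf 1_n$ (degree $1+n$); the cup $\mathbf 1_n\to\mathcal{EF}\mathbf 1_n$ and the cap $\mathcal{EF}\mathbf 1_n\to\mathbf 1_n$ (degree $1-n$). The closed diagram $\mathbf 1_n\to\mathcal{EF}\mathbf 1_n\to\mathbf 1_n$ with $n-1+j\ge 0$ dots, respectively $\mathbf 1_n\to\mathcal{FE}\mathbf 1_n\to\mathbf 1_n$ with $-n-1+j\ge 0$ dots, is the real clockwise, respectively counterclockwise, bubble of degree $2j$; denote it $\circlearrowright_{n,j}$, respectively $\circlearrowleft_{n,j}$. The fake bubbles, which formally carry a negative number of dots, are $$\circlearrowright_{0,0}=c_0^+,\quad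 \circlearrowleft_{0,0}=c_0^-,\quad \circlearrowright_{n,j}=-\tfrac1{\beta_n}\sum_{|\lambda|=j}\alpha_\lambda\circlearrowleft_{n,\lambda_1}\cdots\circlearrowleft_{n,\lambda_m}\ (n<0,\ 0\le j\le -n),\quad \circlearrowleft_{n,j}=-\tfrac1{\beta_n}\sum_{|\lambda|=j}\alpha_\lambda\circlearrowright_{n,\lambda_1}\cdots\circlearrowright_{n,\lambda_m}\ (n>0,\ 0\le j\le n),$$ where $\lambda$ runs over partitions, and the $\alpha_\lambda\in\Bbbk$ are defined by the identities $\delta_{b,0}=\sum_{|\lambda|\le b}\alpha_\lambda e_{\lambda_1}\cdots e_{\lambda_m}e_{b-|\lambda|}$ ($b\ge 0$) in indeterminates $e_1,e_2,\dots$, with $e_0=c_n^-$ for $n<0$ and $e_0=c_n^+$ for $n>0$. Sums over indices below are over non-negative integers, and are empty if the prescribed total is negative. The relations are: 1. caps and cups satisfy the four zigzag identities (so that $\mathcal E$ and $\mathcal F$ are biadjoint), and the dot and the crossing are cyclic: the downward dot and the downward crossing are the mates of the upward ones, under both the left and the right adjunctions; 2. nilHecke relations: the crossing of $\mathcal{EE}$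 squares to zero, the two braid-like composites of three crossings of $\mathcal{EEE}$ agree, and the identity of $\mathcal{EE}$ equals (crossing with a dot at the bottom left) minus (crossing with a dot at the top right), and also equals (crossing with a dot at the top left) minus (crossing with a dot at the bottom right); 3. real bubbles of negative degree vanish, and the real bubbles of degree zero are $\circlearrowright_{n,0}=c_n^+$ for $n\ge 1$ and $\circlearrowleft_{n,0}=c_n^-$ for $n\le -1$; 4. the curl on $\mathcal E$ with its loop to the right, with $n$ the region to the right, equals $-\sum_{f_1+f_2=-n}$ of the $\mathcal E$-strand with $f_1$ dots next to $\circlearrowright_{n,f_2}$ on its right; the curl with its loop to the left, with $n$ the region to the left, equals $\sum_{g_1+g_2=n}$ of the $\mathcal E$-strand with $g_1$ dots next to $\circlearrowleft_{n,g_2}$ on its left; 5. with sideways crossings $\sigma:\mathcal{EF}\mathbf 1_n\to\mathcal{FE}\mathbf 1_n$ and $\sigma':\mathcal{FE}\mathbf 1_n\to\mathcal{EF}\mathbf 1_n$ obtained from the upward crossing by caps and cups, $$\mathrm{Id}_{\mathcal{EF}\mathbf 1_n}=\beta_n\sigma'\sigma-\beta_n\sum_{f_1+f_2+f_3=n-1}\mathrm{cup}_{f_1}\circ\circlearrowleft_{n,f_2}\circ\mathrm{cap}_{f_3},\qquad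 \mathrm{Id}_{\mathcal{FE}\mathbf 1_n}=\beta_n\sigma\sigma'-\beta_n\sum_{g_1+g_2+g_3=-n-1}\mathrm{cup}_{g_1}\circ\circlearrowright_{n,g_2}\circ\mathrm{cap}_{g_3},$$ where $\mathrm{cup}_a$, $\mathrm{cap}_a$ are the cup into, and the cap out of, the 1-morphism in question, carrying $a$ dots. Let $\mathcal U$ denote $\mathcal U_\chi$ for the choice $c_n^\pm=1$, $\beta_n=-1$ for all $n$. **Theorem.** For every $\chi$ as above there is an isomorphism of $\Bbbk$-linear 2-categories $\mathcal M:\mathcal U\to\mathcal U_\chi$ (a strict $\Bbbk$-linear 2-functor with a strict inverse) that is the identity on objects and on 1-morphisms, maps dots and crossings to themselves, and multiplies caps and cups with rightmost region $n$ by the following factors, where $\ell$ denotes an even integer $\ge 0$: - the cap $\mathcal{EF}\mathbf 1_n\to\mathbf 1_n$ by $\frac1{c_n^+}$ and the cap $\mathcal{FE}\mathbf 1_n\to\mathbf 1_n$ by $c_{n+2}^+$, if $n=2\ell$ or $n=2\ell+1$; by $c_{n-2}^-$ and $\frac1{c_n^-}$ respectively, if $n=-2\ell$ or $n=-(2\ell+3)$;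 both by $1$ otherwise; - the cup $\mathbf 1_n\to\mathcal{EF}\mathbf 1_n$ by $\frac1{c_n^+}$ and the cup $\mathbf 1_n\to\mathcal{FE}\mathbf 1_n$ by $c_{n+2}^+$, if $n=2\ell+2$ or $n=2\ell+3$; by $c_{n-2}^-$ and $\frac1{c_n^-}$ respectively, if $n=-(2\ell+1)$ or $n=-(2\ell+2)$; both by $1$ otherwise (for $n=0$ the two descriptions agree). Moreover, for all $j\ge 0$ the bubbles, real or fake, rescale as $$\mathcal M(\circlearrowright_{n,j})=\begin{cases}\frac1{c_n^+}\circlearrowright_{n,j}& n\ge 0\\ -\beta_nc_n^-\circlearrowright_{n,j}& n<0\end{cases}\qquad \mathcal M(\circlearrowleft_{n,j})=\begin{cases}\frac1{c_n^-}\circlearrowleft_{n,j}& n\le 0\\ -\beta_nc_n^+\circlearrowleft_{n,j}& n>0.\end{cases}$$ -/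

import Mathlib

open CategoryTheory
noncomputable section
namespace CatSl2

/-- The letters of a signed sequence: `E` is the sign `+`, `F` is the sign `-`. -/
inductive Letter
  | E
  | F

open Letter

/-- A signed sequence, read from left to right as in a composite such as `E F E 1_n`. -/
abbrev Word := List Letter

/-- The total weight: the 1-morphism with word `w` starting at the object `n` ends at `n + wt w`. -/
def wt : Word → ℤ
  | [] => 0
  | E :: w => wt w + 2
  | F :: w => wt w - 2

theorem wt_append (u v : Word) : wt (u ++ v) = wt u + wt v := by
  induction u with
  | nil => simp [wt]
  | cons a u ih => cases a <;> simp [wt, ih] <;> ring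

/-- The generating 2-morphisms. `Gen w w'` goes from the bottom word `w` to the top word `w'`;
`cupFE : 1 → F E`, `capEF : E F → 1`, and so on. -/
inductive Gen : Word → Word → Type
  | dotUp : Gen [E] [E]
  | dotDown : Gen [F] [F]
  | crossUp : Gen [E, E] [E, E]
  | crossDown : Gen [F, F] [F, F]
  | cupFE : Gen [] [F, E]
  | cupEF : Gen [] [E, F]
  | capFE : Gen [F, E] []
  | capEF : Gen [E, F] []

/-- The degree of a generator whose rightmost region is labelled `n`. -/
def Gen.deg (n : ℤ) : ∀ {w w' : Word}, Gen w w' → ℤ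
  | _, _, .dotUp => 2
  | _, _, .dotDown => 2
  | _, _, .crossUp => -2
  | _, _, .crossDown => -2
  | _, _, .cupFE => 1 + n
  | _, _, .cupEF => 1 - n
  | _, _, .capFE => 1 + n
  | _, _, .capEF => 1 - n

/-- Expressions for string diagrams with rightmost region `n`, bottom word `w` and top word `w'`.
`comp x y` puts `y` on top of `x`; `padL u x` adds identity strands `u` on the left of `x`; `padR v h x`
adds identity strands `v` on the right of `x`, whose rightmost region is then `m = n + wt v`. -/
inductive Pre : ℤ → Word → Word → Type
  | gen (n : ℤ) {w w' : Word} (g : Gen w w') : Pre n w w'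
  | id (n : ℤ) (w : Word) : Pre n w w
  | comp {n : ℤ} {w w' w'' : Word} (x : Pre n w w') (y : Pre n w' w'') : Pre n w w''
  | padL {n : ℤ} (u : Word) {w w' : Word} (x : Pre n w w') : Pre n (u ++ w) (u ++ w')
  | padR {m n : ℤ} (v : Word) (h : m = n + wt v) {w w' : Word} (x : Pre m w w') :
      Pre n (w ++ v) (w' ++ v)

namespace Pre

/-- The identity diagram between two equal words. -/
def eqTo (n : ℤ) {w w' : Word} (h : w = w') : Pre n w w' := h ▸ Pre.id n w

/-- The degree of a diagram: the sum of the degrees of its generators. -/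
def deg : ∀ {n : ℤ} {w w' : Word}, Pre n w w' → ℤ
  | n, _, _, .gen _ g => g.deg n
  | _, _, _, .id _ _ => 0
  | _, _, _, .comp x y => x.deg + y.deg
  | _, _, _, .padL _ x => x.deg
  | _, _, _, .padR _ _ x => x.deg

theorem deg_eqTo (n : ℤ) {w w' : Word} (h : w = w') : (eqTo n h).deg = 0 := by
  subst h; rfl

end Pre

open Pre in
/-- The identifications that hold between string diagrams in any strict 2-category. -/
inductive TwoCatRel : ∀ {n : ℤ} {w w' : Word}, Pre n w w' → Pre n w w' → Prop
  | comp_left {n : ℤ} {w w' w'' : Word} {x x' : Pre n w w'} (y : Pre n w' w'') :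
      TwoCatRel x x' → TwoCatRel (comp x y) (comp x' y)
  | comp_right {n : ℤ} {w w' w'' : Word} (x : Pre n w w') {y y' : Pre n w' w''} :
      TwoCatRel y y' → TwoCatRel (comp x y) (comp x y')
  | padL_congr {n : ℤ} (u : Word) {w w' : Word} {x x' : Pre n w w'} :
      TwoCatRel x x' → TwoCatRel (padL u x) (padL u x')
  | padR_congr {m n : ℤ} (v : Word) (h : m = n + wt v) {w w' : Word} {x x' : Pre m w w'} :
      TwoCatRel x x' → TwoCatRel (padR v h x) (padR v h x')
  | id_comp {n : ℤ} {w w' : Word} (x : Pre n w w') : TwoCatRel (comp (id n w) x) x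
  | comp_id {n : ℤ} {w w' : Word} (x : Pre n w w') : TwoCatRel (comp x (id n w')) x
  | assoc {n : ℤ} {w₁ w₂ w₃ w₄ : Word} (x : Pre n w₁ w₂) (y : Pre n w₂ w₃) (z : Pre n w₃ w₄) :
      TwoCatRel (comp (comp x y) z) (comp x (comp y z))
  | padL_id (n : ℤ) (u w : Word) : TwoCatRel (padL u (id n w)) (id n (u ++ w))
  | padL_comp {n : ℤ} (u : Word) {w w' w'' : Word} (x : Pre n w w') (y : Pre n w' w'') :
      TwoCatRel (padL u (comp x y)) (comp (padL u x) (padL u y))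
  | padR_id {m n : ℤ} (v : Word) (h : m = n + wt v) (w : Word) :
      TwoCatRel (padR v h (id m w)) (id n (w ++ v))
  | padR_comp {m n : ℤ} (v : Word) (h : m = n + wt v) {w w' w'' : Word}
      (x : Pre m w w') (y : Pre m w' w'') :
      TwoCatRel (padR v h (comp x y)) (comp (padR v h x) (padR v h y))
  | padL_nil {n : ℤ} {w w' : Word} (x : Pre n w w') : TwoCatRel (padL [] x) x
  | padL_append {n : ℤ} (u u' : Word) {w w' : Word} (x : Pre n w w') :
      TwoCatRel (padL (u ++ u') x)
        (comp (eqTo n (List.append_assoc u u' w))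
          (comp (padL u (padL u' x)) (eqTo n (List.append_assoc u u' w').symm)))
  | padR_nil {n : ℤ} (h : n = n + wt []) {w w' : Word} (x : Pre n w w') :
      TwoCatRel (padR [] h x)
        (comp (eqTo n (List.append_nil w)) (comp x (eqTo n (List.append_nil w').symm)))
  | padR_append {m m' n : ℤ} (v v' : Word) (h : m = m' + wt v) (h' : m' = n + wt v')
      (h'' : m = n + wt (v ++ v')) {w w' : Word} (x : Pre m w w') :
      TwoCatRel (padR (v ++ v') h'' x)
        (comp (eqTo n (List.append_assoc w v v').symm)
          (comp (padR v' h' (padR v h x)) (eqTo n (List.append_assoc w' v v'))))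
  | padL_padR {m n : ℤ} (u v : Word) (h : m = n + wt v) {w w' : Word} (x : Pre m w w') :
      TwoCatRel (padL u (padR v h x))
        (comp (eqTo n (List.append_assoc u w v).symm)
          (comp (padR v h (padL u x)) (eqTo n (List.append_assoc u w' v))))
  | exchange {m n : ℤ} {w w' v v' : Word} (h : m = n + wt v) (h' : m = n + wt v')
      (x : Pre m w w') (y : Pre n v v') :
      TwoCatRel (comp (padR v h x) (padL w' y)) (comp (padL w y) (padR v' h' x))

theorem TwoCatRel.deg_eq {n : ℤ} {w w' : Word} {x y : Pre n w w'} (h : TwoCatRel x y) :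
    x.deg = y.deg := by
  induction h <;> simp_all [Pre.deg, Pre.deg_eqTo, add_assoc, add_comm]

/-- String diagrams built from the generators: 2-morphisms of the free strict 2-category. -/
def Diag (n : ℤ) (w w' : Word) : Type := Quot (@TwoCatRel n w w')

namespace Diag

variable {m n : ℤ}

/-- A generator as a diagram. -/
def gen (n : ℤ) {w w' : Word} (g : Gen w w') : Diag n w w' := Quot.mk _ (.gen n g)

def eqTo (n : ℤ) {w w' : Word} (h : w = w') : Diag n w w' := Quot.mk _ (.eqTo n h)

def id (n : ℤ) (w : Word) : Diag n w w := Quot.mk _ (.id n w)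

def comp {w w' w'' : Word} (x : Diag n w w') (y : Diag n w' w'') : Diag n w w'' :=
  Quot.map₂ Pre.comp (fun x _ _ h => .comp_right x h) (fun _ _ y h => .comp_left y h) x y

def padL (u : Word) {w w' : Word} (x : Diag n w w') : Diag n (u ++ w) (u ++ w') :=
  Quot.map (Pre.padL u) (fun _ _ h => .padL_congr u h) x

def padR (v : Word) (h : m = n + wt v) {w w' : Word} (x : Diag m w w') :
    Diag n (w ++ v) (w' ++ v) :=
  Quot.map (Pre.padR v h) (fun _ _ h' => .padR_congr v h h') x

def deg {w w' : Word} (x : Diag n w w') : ℤ := Quot.lift Pre.deg (fun _ _ h => h.deg_eq) x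

theorem id_comp {w w' : Word} (x : Diag n w w') : comp (id n w) x = x := by
  induction x using Quot.ind; exact Quot.sound (.id_comp _)

theorem comp_id {w w' : Word} (x : Diag n w w') : comp x (id n w') = x := by
  induction x using Quot.ind; exact Quot.sound (.comp_id _)

theorem assoc {w₁ w₂ w₃ w₄ : Word} (x : Diag n w₁ w₂) (y : Diag n w₂ w₃) (z : Diag n w₃ w₄) :
    comp (comp x y) z = comp x (comp y z) := by
  induction x using Quot.ind; induction y using Quot.ind; induction z using Quot.ind
  exact Quot.sound (.assoc _ _ _)

theorem padL_id (u w : Word) : padL u (id n w) = id n (u ++ w) := Quot.sound (.padL_id n u w)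

theorem padL_comp (u : Word) {w w' w'' : Word} (x : Diag n w w') (y : Diag n w' w'') :
    padL u (comp x y) = comp (padL u x) (padL u y) := by
  induction x using Quot.ind; induction y using Quot.ind; exact Quot.sound (.padL_comp _ _ _)

theorem padR_id (v : Word) (h : m = n + wt v) (w : Word) :
    padR v h (id m w) = id n (w ++ v) := Quot.sound (.padR_id v h w)

theorem padR_comp (v : Word) (h : m = n + wt v) {w w' w'' : Word}
    (x : Diag m w w') (y : Diag m w' w'') :
    padR v h (comp x y) = comp (padR v h x) (padR v h y) := by
  induction x using Quot.ind; induction y using Quot.ind; exact Quot.sound (.padR_comp _ _ _ _)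

theorem padL_nil {w w' : Word} (x : Diag n w w') : padL [] x = x := by
  induction x using Quot.ind; exact Quot.sound (.padL_nil _)

theorem padL_append (u u' : Word) {w w' : Word} (x : Diag n w w') :
    padL (u ++ u') x = comp (eqTo n (List.append_assoc u u' w))
      (comp (padL u (padL u' x)) (eqTo n (List.append_assoc u u' w').symm)) := by
  induction x using Quot.ind; exact Quot.sound (.padL_append _ _ _)

theorem padR_nil (h : n = n + wt []) {w w' : Word} (x : Diag n w w') :
    padR [] h x = comp (eqTo n (List.append_nil w))
      (comp x (eqTo n (List.append_nil w').symm)) := by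
  induction x using Quot.ind; exact Quot.sound (.padR_nil _ _)

theorem padR_append {m' : ℤ} (v v' : Word) (h : m = m' + wt v) (h' : m' = n + wt v')
    (h'' : m = n + wt (v ++ v')) {w w' : Word} (x : Diag m w w') :
    padR (v ++ v') h'' x = comp (eqTo n (List.append_assoc w v v').symm)
      (comp (padR v' h' (padR v h x)) (eqTo n (List.append_assoc w' v v'))) := by
  induction x using Quot.ind; exact Quot.sound (.padR_append _ _ _ _ _ _)

theorem padL_padR (u v : Word) (h : m = n + wt v) {w w' : Word} (x : Diag m w w') :
    padL u (padR v h x) = comp (eqTo n (List.append_assoc u w v).symm)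
      (comp (padR v h (padL u x)) (eqTo n (List.append_assoc u w' v))) := by
  induction x using Quot.ind; exact Quot.sound (.padL_padR _ _ _ _)

theorem exchange {w w' v v' : Word} (h : m = n + wt v) (h' : m = n + wt v')
    (x : Diag m w w') (y : Diag n v v') :
    comp (padR v h x) (padL w' y) = comp (padL w y) (padR v' h' x) := by
  induction x using Quot.ind; induction y using Quot.ind; exact Quot.sound (.exchange _ _ _ _)

theorem eqTo_comp_eqTo {w w' w'' : Word} (h : w = w') (h' : w' = w'') :
    comp (eqTo n h) (eqTo n h') = eqTo n (h.trans h') := by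
  subst h; subst h'; exact id_comp _

theorem padL_eqTo (u : Word) {w w' : Word} (h : w = w') :
    padL u (eqTo n h) = eqTo n (congrArg (u ++ ·) h) := by
  subst h; exact padL_id _ _

theorem padR_eqTo (v : Word) (hm : m = n + wt v) {w w' : Word} (h : w = w') :
    padR v hm (eqTo m h) = eqTo n (congrArg (· ++ v) h) := by
  subst h; exact padR_id _ _ _

theorem deg_comp {w w' w'' : Word} (x : Diag n w w') (y : Diag n w' w'') :
    (comp x y).deg = x.deg + y.deg := by
  induction x using Quot.ind; induction y using Quot.ind; rfl

theorem deg_padL (u : Word) {w w' : Word} (x : Diag n w w') : (padL u x).deg = x.deg := by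
  induction x using Quot.ind; rfl

theorem deg_padR (v : Word) (h : m = n + wt v) {w w' : Word} (x : Diag m w w') :
    (padR v h x).deg = x.deg := by
  induction x using Quot.ind; rfl

theorem deg_eqTo {w w' : Word} (h : w = w') : (eqTo n h).deg = 0 := Pre.deg_eqTo n h

end Diag

section Linear

variable (k : Type*) [Field k]

/-- Formal linear combinations of diagrams. -/
abbrev Lin (n : ℤ) (w w' : Word) : Type _ := Diag n w w' →₀ k

namespace Lin

variable {m n : ℤ}

/-- A generator as an element. -/
def gen (n : ℤ) {w w' : Word} (g : Gen w w') : Lin k n w w' := Finsupp.single (Diag.gen n g) 1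

def id (n : ℤ) (w : Word) : Lin k n w w := Finsupp.single (Diag.id n w) 1

variable {k}

/-- Vertical composition, extended bilinearly; the first argument is the lower one. -/
def comp {w w' w'' : Word} : Lin k n w w' →ₗ[k] Lin k n w' w'' →ₗ[k] Lin k n w w'' :=
  Finsupp.lift _ k _ fun x => Finsupp.lmapDomain k k fun y => x.comp y

def padL (u : Word) {w w' : Word} : Lin k n w w' →ₗ[k] Lin k n (u ++ w) (u ++ w') :=
  Finsupp.lmapDomain k k (Diag.padL u)

def padR (v : Word) (h : m = n + wt v) {w w' : Word} :
    Lin k m w w' →ₗ[k] Lin k n (w ++ v) (w' ++ v) :=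
  Finsupp.lmapDomain k k (Diag.padR v h)

@[simp] theorem comp_single {w w' w'' : Word} (x : Diag n w w') (y : Diag n w' w'') (a b : k) :
    comp (Finsupp.single x a) (Finsupp.single y b) = Finsupp.single (x.comp y) (a * b) := by
  simp [comp, Finsupp.mapDomain_single]

@[simp] theorem padL_single (u : Word) {w w' : Word} (x : Diag n w w') (a : k) :
    padL u (Finsupp.single x a) = Finsupp.single (x.padL u) a := by
  simp [padL, Finsupp.mapDomain_single]

@[simp] theorem padR_single (v : Word) (h : m = n + wt v) {w w' : Word} (x : Diag m w w') (a : k) :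
    padR v h (Finsupp.single x a) = Finsupp.single (x.padR v h) a := by
  simp [padR, Finsupp.mapDomain_single]

end Lin
end Linear

/-- `x ⊚ y` is the diagram `x` with `y` stacked on top of it. -/
local notation:75 x:75 " ⊚ " y:76 => Lin.comp x y

/-- The parameters: `β n` for `n ∈ ℤ`, `c_n^+ = cPlus n` for `n ≥ 0` and `c_n^- = cMinus (-n)` for
`n ≤ 0`, all of them invertible. -/
structure Params (k : Type*) [Field k] where
  β : ℤ → kˣ
  cPlus : ℕ → kˣ
  cMinus : ℕ → kˣ

namespace Params
variable {k : Type*} [Field k] (χ : Params k)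

/-- `c_n^+`, used only for `n ≥ 0`. -/
def cp (n : ℤ) : kˣ := χ.cPlus n.toNat

/-- `c_n^-`, used only for `n ≤ 0`. -/
def cm (n : ℤ) : kˣ := χ.cMinus (-n).toNat

/-- The constraints on the parameters. -/
structure Consistent : Prop where
  zero : -(χ.cp 0 * χ.cm 0 * χ.β 0) = 1
  one : χ.cm (-1) = (χ.cp 1)⁻¹
  minus : ∀ n : ℤ, n ≤ 0 → χ.cm (n - 2) = -(χ.β n * χ.cm n)
  plus : ∀ n : ℤ, 0 ≤ n → χ.cp (n + 2) = -(χ.β n * χ.cp n)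

/-- The parameters with `β n = -1` and all `c_n^± = 1`. -/
def standard (k : Type*) [Field k] : Params k := ⟨fun _ => -1, fun _ => 1, fun _ => 1⟩
end Params

section Bubbles
variable {k : Type*} [Field k]

/-- The polynomials `P_s` in `e_1, e_2, …` determined by `∑_{s + r = b} P_s e_r = δ_{b,0}` for all `b ≥ 0`,
where `e_0 = c`. The variable `X i` stands for `e_i`. -/
def alphaPoly (c : kˣ) : ℕ → MvPolynomial ℕ k
  | 0 => MvPolynomial.C (c⁻¹ : kˣ).val
  | s + 1 => - MvPolynomial.C (c⁻¹ : kˣ).val *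
      ∑ r : Fin (s + 1), alphaPoly c (s - r) * MvPolynomial.X (r + 1 : ℕ)

/-- The defining property of `alphaPoly`. -/
theorem alphaPoly_spec (c : kˣ) (b : ℕ) :
    ∑ p ∈ Finset.HasAntidiagonal.antidiagonal b, alphaPoly c p.1 *
      (if p.2 = 0 then MvPolynomial.C c.val else MvPolynomial.X p.2) = if b = 0 then 1 else 0 := by
  cases b with
  | zero => simp [alphaPoly, ← map_mul]
  | succ s =>
    rw [Finset.Nat.sum_antidiagonal_eq_sum_range_succ_mk, ← Finset.sum_range_reflect,
      Finset.sum_range_succ']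
    have h : ∀ r ∈ Finset.range (s + 1),
        alphaPoly c (s + 1 + 1 - 1 - (r + 1)) * (if s + 1 - (s + 1 + 1 - 1 - (r + 1)) = 0 then
          MvPolynomial.C c.val else MvPolynomial.X (s + 1 - (s + 1 + 1 - 1 - (r + 1)))) =
        alphaPoly c (s - r) * MvPolynomial.X (r + 1 : ℕ) := by
      intro r hr
      rw [Finset.mem_range] at hr
      have h1 : s + 1 + 1 - 1 - (r + 1) = s - r := by omega
      have h2 : s + 1 - (s - r) = r + 1 := by omega
      rw [h1, h2, if_neg (by omega)]
    rw [Finset.sum_congr rfl h, Finset.sum_range]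
    have hc : (MvPolynomial.C (c⁻¹ : kˣ).val * MvPolynomial.C c.val : MvPolynomial ℕ k) = 1 := by
      rw [← map_mul]; simp
    simp only [Nat.succ_eq_add_one, Nat.add_sub_cancel, Nat.sub_zero, Nat.sub_self, if_true,
      alphaPoly, Nat.add_one_ne_zero, if_false]
    linear_combination (- ∑ r : Fin (s + 1), alphaPoly c (s - r) * MvPolynomial.X (r + 1 : ℕ)) * hc

/-- The coefficient `α_λ` for a partition `λ` of `j`: the coefficient of `e_λ = e_{λ_1} ⋯ e_{λ_m}` in the
solution of `δ_{b,0} = ∑_{|λ| ≤ b} α_λ e_λ e_{b - |λ|}`, where `e_0 = c`. -/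
def alpha (c : kˣ) {j : ℕ} (l : Nat.Partition j) : k :=
  (alphaPoly c j).coeff (Multiset.toFinsupp l.parts)

variable (k)
/-- An upward strand with `a` dots. -/
def dots (n : ℤ) : ℕ → Lin k n [E] [E]
  | 0 => Lin.id k n [E]
  | a + 1 => dots n a ⊚ Lin.gen k n .dotUp

/-- The cap `E F → 1` with `a` dots on its upward strand; similarly for the other three. -/
def capEF (n : ℤ) (a : ℕ) : Lin k n [E, F] [] := Lin.padR [F] rfl (dots k _ a) ⊚ Lin.gen k n .capEF
def capFE (n : ℤ) (a : ℕ) : Lin k n [F, E] [] := Lin.padL [F] (dots k n a) ⊚ Lin.gen k n .capFE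
def cupEF (n : ℤ) (a : ℕ) : Lin k n [] [E, F] := Lin.gen k n .cupEF ⊚ Lin.padR [F] rfl (dots k _ a)
def cupFE (n : ℤ) (a : ℕ) : Lin k n [] [F, E] := Lin.gen k n .cupFE ⊚ Lin.padL [F] (dots k n a)

/-- The clockwise bubble with `a` dots in the region `n`. -/
def cwReal (n : ℤ) (a : ℕ) : Lin k n [] [] := cupEF k n a ⊚ Lin.gen k n .capEF
/-- The counterclockwise bubble with `a` dots in the region `n`. -/
def ccwReal (n : ℤ) (a : ℕ) : Lin k n [] [] := cupFE k n a ⊚ Lin.gen k n .capFE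

variable {k}
/-- The product of the bubbles `f i` for `i` in a list. -/
def prodBub {n : ℤ} (f : ℕ → Lin k n [] []) : List ℕ → Lin k n [] []
  | [] => Lin.id k n []
  | i :: l => f i ⊚ prodBub f l

/-- `∑_{|λ| = j} α_λ f_{λ_1} ⋯ f_{λ_m}`. -/
def fakeSum {n : ℤ} (c : kˣ) (f : ℕ → Lin k n [] []) (j : ℕ) : Lin k n [] [] :=
  ∑ l : Nat.Partition j, alpha c l • prodBub f (l.parts.sort (· ≥ ·))

variable (χ : Params k)

/-- The clockwise bubble of degree `2 j` in the region `n`, formally carrying `n - 1 + j` dots. For `n < 0`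
and `0 ≤ j ≤ -n` this is a fake bubble, and so is the bubble of degree zero for `n = 0`. -/
def cw (n : ℤ) (j : ℕ) : Lin k n [] [] :=
  if n < 0 ∧ (j : ℤ) ≤ -n then
    -((χ.β n)⁻¹ : kˣ).val • fakeSum (χ.cm n) (fun i => ccwReal k n (-n - 1 + i).toNat) j
  else if n = 0 ∧ j = 0 then (χ.cp 0).val • Lin.id k n []
  else cwReal k n (n - 1 + j).toNat

/-- The counterclockwise bubble of degree `2 j` in the region `n`, formally carrying `-n - 1 + j` dots. For
`n > 0` and `0 ≤ j ≤ n` this is a fake bubble, and so is the bubble of degree zero for `n = 0`. -/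
def ccw (n : ℤ) (j : ℕ) : Lin k n [] [] :=
  if 0 < n ∧ (j : ℤ) ≤ n then
    -((χ.β n)⁻¹ : kˣ).val • fakeSum (χ.cp n) (fun i => cwReal k n (n - 1 + i).toNat) j
  else if n = 0 ∧ j = 0 then (χ.cm 0).val • Lin.id k n []
  else ccwReal k n (-n - 1 + j).toNat

variable (k)
/-- The sideways crossing `E F → F E`. -/
def sideEF (n : ℤ) : Lin k n [E, F] [F, E] :=
  Lin.padR [E, F] rfl (Lin.gen k _ .cupFE) ⊚ Lin.padL [F] (Lin.padR [F] rfl (Lin.gen k _ .crossUp)) ⊚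
    Lin.padL [F, E] (Lin.gen k n .capEF)

/-- The sideways crossing `F E → E F`. -/
def sideFE (n : ℤ) : Lin k n [F, E] [E, F] :=
  Lin.padL [F, E] (Lin.gen k n .cupEF) ⊚ Lin.padL [F] (Lin.padR [F] rfl (Lin.gen k _ .crossUp)) ⊚
    Lin.padR [E, F] rfl (Lin.gen k _ .capFE)

/-- A dot on the left strand of `E E`. -/
def dotL (n : ℤ) : Lin k n [E, E] [E, E] := Lin.padR [E] rfl (Lin.gen k _ .dotUp)
/-- A dot on the right strand of `E E`. -/
def dotR (n : ℤ) : Lin k n [E, E] [E, E] := Lin.padL [E] (Lin.gen k n .dotUp)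

/-- Pairs of natural numbers with sum `z`; none if `z < 0`. -/
def pairs (z : ℤ) : Finset (ℕ × ℕ) := if 0 ≤ z then Finset.HasAntidiagonal.antidiagonal z.toNat else ∅
/-- Triples of natural numbers with sum `z`; none if `z < 0`. -/
def triples (z : ℤ) : Finset (Fin 3 → ℕ) :=
  if 0 ≤ z then Finset.Nat.antidiagonalTuple 3 z.toNat else ∅

open Lin in
/-- The defining relations. -/
inductive Rel (χ : Params k) : ∀ {n : ℤ} {w w' : Word}, Lin k n w w' → Lin k n w w' → Prop
  -- biadjointness
  | zigzagE (n : ℤ) : Rel χ (w := [E]) (w' := [E])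
      (padR [E] rfl (gen k _ .cupEF) ⊚ padL [E] (gen k n .capFE)) (id k n [E])
  | zigzagF (n : ℤ) : Rel χ (w := [F]) (w' := [F])
      (padR [F] rfl (gen k _ .cupFE) ⊚ padL [F] (gen k n .capEF)) (id k n [F])
  | zagzigE (n : ℤ) : Rel χ (w := [E]) (w' := [E])
      (padL [E] (gen k n .cupFE) ⊚ padR [E] rfl (gen k _ .capEF)) (id k n [E])
  | zagzigF (n : ℤ) : Rel χ (w := [F]) (w' := [F])
      (padL [F] (gen k n .cupEF) ⊚ padR [F] rfl (gen k _ .capFE)) (id k n [F])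
  -- cyclicity
  | dot_right (n : ℤ) : Rel χ (w := [F]) (w' := [F])
      (padL [F] (gen k n .cupEF) ⊚ padL [F] (padR [F] rfl (gen k _ .dotUp)) ⊚
        padR [F] rfl (gen k _ .capFE))
      (gen k n .dotDown)
  | dot_left (n : ℤ) : Rel χ (w := [F]) (w' := [F])
      (padR [F] rfl (gen k _ .cupFE) ⊚ padL [F] (padR [F] rfl (gen k _ .dotUp)) ⊚
        padL [F] (gen k n .capEF))
      (gen k n .dotDown)
  | cross_right (n : ℤ) : Rel χ (w := [F, F]) (w' := [F, F])
      (padL [F, F] (gen k n .cupEF) ⊚ padL [F, F, E] (padR [F] rfl (gen k _ .cupEF)) ⊚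
        padL [F, F] (padR [F, F] rfl (gen k _ .crossUp)) ⊚
        padL [F] (padR [E, F, F] rfl (gen k _ .capFE)) ⊚ padR [F, F] rfl (gen k _ .capFE))
      (gen k n .crossDown)
  | cross_left (n : ℤ) : Rel χ (w := [F, F]) (w' := [F, F])
      (padR [F, F] rfl (gen k _ .cupFE) ⊚ padL [F] (padR [E, F, F] rfl (gen k _ .cupFE)) ⊚
        padL [F, F] (padR [F, F] rfl (gen k _ .crossUp)) ⊚
        padL [F, F, E] (padR [F] rfl (gen k _ .capEF)) ⊚ padL [F, F] (gen k n .capEF))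
      (gen k n .crossDown)
  -- nilHecke
  | cross_cross (n : ℤ) : Rel χ (gen k n .crossUp ⊚ gen k n .crossUp) 0
  | braid (n : ℤ) : Rel χ (w := [E, E, E]) (w' := [E, E, E])
      (padR [E] rfl (gen k _ .crossUp) ⊚ padL [E] (gen k n .crossUp) ⊚
        padR [E] rfl (gen k _ .crossUp))
      (padL [E] (gen k n .crossUp) ⊚ padR [E] rfl (gen k _ .crossUp) ⊚
        padL [E] (gen k n .crossUp))
  | dot_slide (n : ℤ) : Rel χ (w := [E, E]) (w' := [E, E])
      (dotL k n ⊚ gen k n .crossUp - gen k n .crossUp ⊚ dotR k n)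
      (id k n [E, E])
  | dot_slide' (n : ℤ) : Rel χ (w := [E, E]) (w' := [E, E])
      (gen k n .crossUp ⊚ dotL k n - dotR k n ⊚ gen k n .crossUp)
      (id k n [E, E])
  -- bubbles
  | cw_neg (n : ℤ) (a : ℕ) (h : (a : ℤ) < n - 1) : Rel χ (cwReal k n a) 0
  | ccw_neg (n : ℤ) (a : ℕ) (h : (a : ℤ) < -n - 1) : Rel χ (ccwReal k n a) 0
  | cw_zero (n : ℤ) (h : 1 ≤ n) :
      Rel χ (cwReal k n (n - 1).toNat) ((χ.cp n).val • id k n [])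
  | ccw_zero (n : ℤ) (h : n ≤ -1) :
      Rel χ (ccwReal k n (-n - 1).toNat) ((χ.cm n).val • id k n [])
  -- curls
  | curl_right (n : ℤ) : Rel χ (w := [E]) (w' := [E])
      (padL [E] (gen k n .cupEF) ⊚ padR [F] rfl (gen k _ .crossUp) ⊚ padL [E] (gen k n .capEF))
      (-∑ f ∈ pairs (-n), dots k n f.1 ⊚ padL [E] (cw χ n f.2))
  | curl_left (n r : ℤ) (h : n = r + wt [E]) : Rel χ (w := [E]) (w' := [E])
      (padR [E] h (gen k n .cupFE) ⊚ padL [F] (gen k r .crossUp) ⊚ padR [E] h (gen k n .capFE))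
      (∑ g ∈ pairs n, dots k r g.1 ⊚ padR [E] h (ccw χ n g.2))
  | ident_EF (n : ℤ) : Rel χ
      (id k n [E, F])
      ((χ.β n).val • (sideEF k n ⊚ sideFE k n) -
        (χ.β n).val • ∑ f ∈ triples (n - 1), capEF k n (f 2) ⊚ ccw χ n (f 1) ⊚ cupEF k n (f 0))
  | ident_FE (n : ℤ) : Rel χ
      (id k n [F, E])
      ((χ.β n).val • (sideFE k n ⊚ sideEF k n) -
        (χ.β n).val • ∑ g ∈ triples (-n - 1), capFE k n (g 2) ⊚ cw χ n (g 1) ⊚ cupFE k n (g 0))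
end Bubbles

section Quotient
variable {k : Type*} [Field k] (χ : Params k)

/-- Membership in the 2-sided ideal generated by the defining relations. -/
inductive InIdeal : ∀ {n : ℤ} {w w' : Word}, Lin k n w w' → Prop
  | rel {n : ℤ} {w w' : Word} {x y : Lin k n w w'} : Rel k χ x y → InIdeal (x - y)
  | zero (n : ℤ) (w w' : Word) : InIdeal (0 : Lin k n w w')
  | add {n : ℤ} {w w' : Word} {x y : Lin k n w w'} : InIdeal x → InIdeal y → InIdeal (x + y)
  | smul {n : ℤ} {w w' : Word} (a : k) {x : Lin k n w w'} : InIdeal x → InIdeal (a • x)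
  | comp_left {n : ℤ} {w w' w'' : Word} {x : Lin k n w w'} (y : Lin k n w' w'') :
      InIdeal x → InIdeal (x ⊚ y)
  | comp_right {n : ℤ} {w w' w'' : Word} (x : Lin k n w w') {y : Lin k n w' w''} :
      InIdeal y → InIdeal (x ⊚ y)
  | padL {n : ℤ} (u : Word) {w w' : Word} {x : Lin k n w w'} : InIdeal x → InIdeal (Lin.padL u x)
  | padR {m n : ℤ} (v : Word) (h : m = n + wt v) {w w' : Word} {x : Lin k m w w'} :
      InIdeal x → InIdeal (Lin.padR v h x)

def ideal (n : ℤ) (w w' : Word) : Submodule k (Lin k n w w') where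
  carrier := {x | InIdeal χ x}
  add_mem' := .add
  zero_mem' := .zero n w w'
  smul_mem' := fun a _ h => .smul a h

/-- Linear combinations of diagrams modulo the defining relations. -/
abbrev Two (n : ℤ) (w w' : Word) : Type _ := Lin k n w w' ⧸ ideal χ n w w'

namespace Two
variable {m n : ℤ}

def ofLin {w w' : Word} : Lin k n w w' →ₗ[k] Two χ n w w' := (ideal χ n w w').mkQ

/-- The class of a diagram. -/
def diag {w w' : Word} (D : Diag n w w') : Two χ n w w' := ofLin χ (Finsupp.single D 1)

variable {χ}

def comp {w w' w'' : Word} : Two χ n w w' →ₗ[k] Two χ n w' w'' →ₗ[k] Two χ n w w'' :=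
  (ideal χ n w w').liftQ
    (LinearMap.mk₂ k
      (fun x y => (ideal χ n w' w'').mapQ (ideal χ n w w'') (Lin.comp x)
        (fun _ h => InIdeal.comp_right x h) y)
      (fun x x' y => by
        induction y using Submodule.Quotient.induction_on
        simp [Submodule.mapQ_apply]
        rfl)
      (fun c x y => by
        induction y using Submodule.Quotient.induction_on
        simp [Submodule.mapQ_apply]
        rfl)
      (fun x y y' => by simp)
      (fun c x y => by simp))
    (fun x h => by
      rw [LinearMap.mem_ker]
      refine LinearMap.ext fun y => ?_
      induction y using Submodule.Quotient.induction_on with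
      | _ y => exact (Submodule.Quotient.mk_eq_zero (ideal χ n w w'')).2 (InIdeal.comp_left y h))

def padL (u : Word) {w w' : Word} : Two χ n w w' →ₗ[k] Two χ n (u ++ w) (u ++ w') :=
  (ideal χ n w w').mapQ _ (Lin.padL u) fun _ h => InIdeal.padL u h

def padR (v : Word) (h : m = n + wt v) {w w' : Word} :
    Two χ m w w' →ₗ[k] Two χ n (w ++ v) (w' ++ v) :=
  (ideal χ m w w').mapQ _ (Lin.padR v h) fun _ h' => InIdeal.padR v h h'

@[simp] theorem comp_diag {w w' w'' : Word} (x : Diag n w w') (y : Diag n w' w'') :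
    comp (diag χ x) (diag χ y) = diag χ (x.comp y) := by
  change ofLin χ (Lin.comp _ _) = _
  simp [diag]

@[simp] theorem padL_diag (u : Word) {w w' : Word} (x : Diag n w w') :
    padL u (diag χ x) = diag χ (x.padL u) := by
  change ofLin χ (Lin.padL _ _) = _
  simp [diag]

@[simp] theorem padR_diag (v : Word) (h : m = n + wt v) {w w' : Word} (x : Diag m w w') :
    padR v h (diag χ x) = diag χ (x.padR v h) := by
  change ofLin χ (Lin.padR _ _ _) = _
  simp [diag]

theorem ofLin_comp {w w' w'' : Word} (x : Lin k n w w') (y : Lin k n w' w'') :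
    ofLin χ (x ⊚ y) = comp (ofLin χ x) (ofLin χ y) := rfl

@[elab_as_elim]
theorem induction {w w' : Word} {p : Two χ n w w' → Prop} (x : Two χ n w w')
    (hd : ∀ D, p (diag χ D)) (h0 : p 0) (ha : ∀ x y, p x → p y → p (x + y))
    (hs : ∀ (a : k) x, p x → p (a • x)) : p x := by
  induction x using Submodule.Quotient.induction_on with
  | _ x =>
    induction x using Finsupp.induction_linear with
    | zero => exact h0
    | add x y hx hy => exact ha _ _ hx hy
    | single D a =>
      have : (Finsupp.single D a : Lin k n w w') = a • Finsupp.single D 1 := by simp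
      rw [this]
      exact hs a _ (hd D)

variable (χ)
def id (n : ℤ) (w : Word) : Two χ n w w := diag χ (Diag.id n w)
def eqTo (n : ℤ) {w w' : Word} (h : w = w') : Two χ n w w' := diag χ (Diag.eqTo n h)
variable {χ}

theorem id_comp {w w' : Word} (x : Two χ n w w') : comp (id χ n w) x = x := by
  induction x using induction <;> simp_all [id, Diag.id_comp]

theorem comp_id {w w' : Word} (x : Two χ n w w') : comp x (id χ n w') = x := by
  induction x using induction <;> simp_all [id, Diag.comp_id]

theorem assoc {w₁ w₂ w₃ w₄ : Word} (x : Two χ n w₁ w₂) (y : Two χ n w₂ w₃) (z : Two χ n w₃ w₄) :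
    comp (comp x y) z = comp x (comp y z) := by
  induction x using induction with
  | hd x =>
    induction y using induction with
    | hd y => induction z using induction <;> simp_all [Diag.assoc]
    | _ => simp_all
  | _ => simp_all

theorem padL_id (u w : Word) : padL u (id χ n w) = id χ n (u ++ w) := by
  simp [id, Diag.padL_id]

theorem padL_comp (u : Word) {w w' w'' : Word} (x : Two χ n w w') (y : Two χ n w' w'') :
    padL u (comp x y) = comp (padL u x) (padL u y) := by
  induction x using induction with
  | hd x => induction y using induction <;> simp_all [Diag.padL_comp]
  | _ => simp_all

theorem padR_id (v : Word) (h : m = n + wt v) (w : Word) :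
    padR v h (id χ m w) = id χ n (w ++ v) := by
  simp [id, Diag.padR_id]

theorem padR_comp (v : Word) (h : m = n + wt v) {w w' w'' : Word}
    (x : Two χ m w w') (y : Two χ m w' w'') :
    padR v h (comp x y) = comp (padR v h x) (padR v h y) := by
  induction x using induction with
  | hd x => induction y using induction <;> simp_all [Diag.padR_comp]
  | _ => simp_all

theorem padL_nil {w w' : Word} (x : Two χ n w w') : padL [] x = x := by
  induction x using induction with
  | hd x => exact (padL_diag [] x).trans (congrArg _ (Diag.padL_nil x))
  | h0 => exact map_zero _
  | ha x y hx hy => exact (map_add _ _ _).trans (congrArg₂ _ hx hy)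
  | hs a x hx => exact (map_smul _ _ _).trans (congrArg _ hx)

theorem padL_append (u u' : Word) {w w' : Word} (x : Two χ n w w') :
    padL (u ++ u') x = comp (eqTo χ n (List.append_assoc u u' w))
      (comp (padL u (padL u' x)) (eqTo χ n (List.append_assoc u u' w').symm)) := by
  induction x using induction <;> simp_all [eqTo, Diag.padL_append]

theorem padR_nil (h : n = n + wt []) {w w' : Word} (x : Two χ n w w') :
    padR [] h x = comp (eqTo χ n (List.append_nil w))
      (comp x (eqTo χ n (List.append_nil w').symm)) := by
  induction x using induction <;> simp_all [eqTo, Diag.padR_nil]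

theorem padR_append {m' : ℤ} (v v' : Word) (h : m = m' + wt v) (h' : m' = n + wt v')
    (h'' : m = n + wt (v ++ v')) {w w' : Word} (x : Two χ m w w') :
    padR (v ++ v') h'' x = comp (eqTo χ n (List.append_assoc w v v').symm)
      (comp (padR v' h' (padR v h x)) (eqTo χ n (List.append_assoc w' v v'))) := by
  induction x using induction <;> simp_all [eqTo, Diag.padR_append v v' h h' h'']

theorem padL_padR (u v : Word) (h : m = n + wt v) {w w' : Word} (x : Two χ m w w') :
    padL u (padR v h x) = comp (eqTo χ n (List.append_assoc u w v).symm)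
      (comp (padR v h (padL u x)) (eqTo χ n (List.append_assoc u w' v))) := by
  induction x using induction <;> simp_all [eqTo, Diag.padL_padR]

theorem exchange {w w' v v' : Word} (h : m = n + wt v) (h' : m = n + wt v')
    (x : Two χ m w w') (y : Two χ n v v') :
    comp (padR v h x) (padL w' y) = comp (padL w y) (padR v' h' x) := by
  induction x using induction with
  | hd x => induction y using induction <;> simp_all [Diag.exchange h h']
  | _ => simp_all

theorem eqTo_comp_eqTo {w w' w'' : Word} (h : w = w') (h' : w' = w'') :
    comp (eqTo χ n h) (eqTo χ n h') = eqTo χ n (h.trans h') := by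
  simp [eqTo, Diag.eqTo_comp_eqTo]

theorem padL_eqTo (u : Word) {w w' : Word} (h : w = w') :
    padL u (eqTo χ n h) = eqTo χ n (congrArg (u ++ ·) h) := by
  simp [eqTo, Diag.padL_eqTo]

theorem padR_eqTo (v : Word) (hm : m = n + wt v) {w w' : Word} (h : w = w') :
    padR v hm (eqTo χ m h) = eqTo χ n (congrArg (· ++ v) h) := by
  simp [eqTo, Diag.padR_eqTo]

variable (χ)
/-- The span of the diagrams of degree `d`. -/
def homog (n : ℤ) (w w' : Word) (d : ℤ) : Submodule k (Two χ n w w') :=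
  Submodule.span k {x | ∃ D : Diag n w w', D.deg = d ∧ x = diag χ D}
variable {χ}

theorem diag_mem {w w' : Word} (D : Diag n w w') {d : ℤ} (h : D.deg = d) :
    diag χ D ∈ homog χ n w w' d := Submodule.subset_span ⟨D, h, rfl⟩

theorem comp_mem {w w' w'' : Word} {x : Two χ n w w'} {y : Two χ n w' w''} {d d' e : ℤ}
    (hx : x ∈ homog χ n w w' d) (hy : y ∈ homog χ n w' w'' d') (he : d + d' = e) :
    comp x y ∈ homog χ n w w'' e := by
  refine (Submodule.map₂_span_span k comp _ _).le.trans (Submodule.span_mono ?_)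
    (Submodule.apply_mem_map₂ _ hx hy)
  rintro _ ⟨_, ⟨D, hD, rfl⟩, _, ⟨D', hD', rfl⟩, rfl⟩
  exact ⟨D.comp D', by rw [Diag.deg_comp, hD, hD', he], comp_diag _ _⟩

theorem padL_mem (u : Word) {w w' : Word} {x : Two χ n w w'} {d : ℤ}
    (hx : x ∈ homog χ n w w' d) : padL u x ∈ homog χ n (u ++ w) (u ++ w') d := by
  refine (Submodule.map_span (padL u) _).le.trans (Submodule.span_mono ?_)
    (Submodule.mem_map_of_mem hx)
  rintro _ ⟨_, ⟨D, hD, rfl⟩, rfl⟩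
  exact ⟨D.padL u, by rw [Diag.deg_padL, hD], padL_diag _ _⟩

theorem padR_mem (v : Word) (h : m = n + wt v) {w w' : Word} {x : Two χ m w w'} {d : ℤ}
    (hx : x ∈ homog χ m w w' d) : padR v h x ∈ homog χ n (w ++ v) (w' ++ v) d := by
  refine (Submodule.map_span (padR v h) _).le.trans (Submodule.span_mono ?_)
    (Submodule.mem_map_of_mem hx)
  rintro _ ⟨_, ⟨D, hD, rfl⟩, rfl⟩
  exact ⟨D.padR v h, by rw [Diag.deg_padR, hD], padR_diag _ _ _⟩

theorem id_mem (w : Word) {d : ℤ} (h : d = 0) : id χ n w ∈ homog χ n w w d :=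
  diag_mem _ (h ▸ Diag.deg_eqTo rfl)

theorem eqTo_mem {w w' : Word} (hw : w = w') {d : ℤ} (h : d = 0) :
    eqTo χ n hw ∈ homog χ n w w' d :=
  diag_mem _ (h ▸ Diag.deg_eqTo hw)

end Two
end Quotient
section Additive
open Bicategory
open scoped Classical
universe u v w

section Mat
variable {C : Type v} [Category.{w} C] [Preadditive C]

/-- The isomorphism of formal direct sums given by a bijection of index sets and isomorphisms of
corresponding summands: here the matrix itself. -/
def reindexHom {F G : Mat_ C} (e : F.ι ≃ G.ι) (φ : ∀ i, F.X i ≅ G.X (e i)) : F ⟶ G :=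
  fun i j => if h : e i = j then (φ i).hom ≫ eqToHom (congrArg G.X h) else 0

def reindexInv {F G : Mat_ C} (e : F.ι ≃ G.ι) (φ : ∀ i, F.X i ≅ G.X (e i)) : G ⟶ F :=
  fun j i => if h : e i = j then eqToHom (congrArg G.X h.symm) ≫ (φ i).inv else 0

def reindex {F G : Mat_ C} (e : F.ι ≃ G.ι) (φ : ∀ i, F.X i ≅ G.X (e i)) : F ≅ G where
  hom := reindexHom e φ
  inv := reindexInv e φ
  hom_inv_id := by
    ext i i'
    rw [Mat_.comp_apply, Finset.sum_eq_single (e i)]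
    · by_cases h : i = i'
      · subst h; simp [reindexHom, reindexInv]
      · rw [Mat_.id_apply_of_ne _ _ _ h, reindexInv,
          dif_neg (fun h' => h (e.injective h').symm)]
        simp
    · intro j _ hj; rw [reindexHom, dif_neg (Ne.symm hj)]; simp
    · simp
  inv_hom_id := by
    ext j j'
    obtain ⟨i, rfl⟩ := e.surjective j
    rw [Mat_.comp_apply, Finset.sum_eq_single i]
    · by_cases h : e i = j'
      · subst h; simp [reindexHom, reindexInv]
      · rw [Mat_.id_apply_of_ne _ _ _ h, reindexHom, dif_neg h]; simp
    · intro j _ hj; rw [reindexInv, dif_neg (fun h => hj (e.injective h))]; simp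
    · simp

theorem reindex_hom_apply {F G : Mat_ C} (e : F.ι ≃ G.ι) (φ : ∀ i, F.X i ≅ G.X (e i)) (i j) :
    (reindex e φ).hom i j = if h : e i = j then (φ i).hom ≫ eqToHom (congrArg G.X h) else 0 := rfl

theorem reindex_hom_comp {F G H : Mat_ C} (e : F.ι ≃ G.ι) (φ : ∀ i, F.X i ≅ G.X (e i))
    (M : G ⟶ H) (i j) : ((reindex e φ).hom ≫ M) i j = (φ i).hom ≫ M (e i) j := by
  rw [Mat_.comp_apply, Finset.sum_eq_single (e i)]
  · simp [reindex_hom_apply]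
  · intro j _ hj; rw [reindex_hom_apply, dif_neg (Ne.symm hj)]; simp
  · simp

theorem comp_reindex_inv {F G H : Mat_ C} (e : F.ι ≃ G.ι) (φ : ∀ i, F.X i ≅ G.X (e i))
    (M : H ⟶ G) (j i) : (M ≫ (reindex e φ).inv) j i = M j (e i) ≫ (φ i).inv := by
  rw [Mat_.comp_apply, Finset.sum_eq_single (e i)]
  · simp [reindex, reindexInv]
  · intro j _ hj
    have : (reindex e φ).inv j i = 0 := dif_neg (Ne.symm hj)
    rw [this]; simp
  · simp

theorem reindex_conj {F G F' G' : Mat_ C} (e : F.ι ≃ G.ι) (φ : ∀ i, F.X i ≅ G.X (e i))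
    (e' : F'.ι ≃ G'.ι) (φ' : ∀ i, F'.X i ≅ G'.X (e' i)) (M : F ⟶ F') (N : G ⟶ G')
    (h : ∀ i j, M i j = (φ i).hom ≫ N (e i) (e' j) ≫ (φ' j).inv) :
    M = (reindex e φ).hom ≫ N ≫ (reindex e' φ').inv := by
  ext i j
  rw [reindex_hom_comp, comp_reindex_inv, h]

end Mat

/-- Composition of 1-morphisms with 2-morphisms is additive. -/
class LocallyAdditive (B : Type u) [Bicategory.{w, v} B] [∀ a b : B, Preadditive (a ⟶ b)] :
    Prop where
  whiskerLeft_add : ∀ {a b c : B} (f : a ⟶ b) {g h : b ⟶ c} (η θ : g ⟶ h),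
    f ◁ (η + θ) = f ◁ η + f ◁ θ
  add_whiskerRight : ∀ {a b c : B} {f g : a ⟶ b} (η θ : f ⟶ g) (h : b ⟶ c),
    (η + θ) ▷ h = η ▷ h + θ ▷ h

variable {B : Type u} [Bicategory.{w, v} B] [∀ a b : B, Preadditive (a ⟶ b)] [LocallyAdditive B]

section
variable {a b c : B}

@[simp] theorem whiskerLeft_zero (f : a ⟶ b) (g h : b ⟶ c) : f ◁ (0 : g ⟶ h) = 0 := by
  have := LocallyAdditive.whiskerLeft_add f (0 : g ⟶ h) 0
  simpa using this

@[simp] theorem zero_whiskerRight (f g : a ⟶ b) (h : b ⟶ c) : (0 : f ⟶ g) ▷ h = 0 := by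
  have := LocallyAdditive.add_whiskerRight (0 : f ⟶ g) 0 h
  simpa using this

theorem whiskerLeft_sum {ι : Type*} (s : Finset ι) (f : a ⟶ b) {g h : b ⟶ c} (η : ι → (g ⟶ h)) :
    f ◁ (∑ i ∈ s, η i) = ∑ i ∈ s, f ◁ η i := by
  induction s using Finset.induction_on with
  | empty => simp
  | insert i s hi ih =>
    rw [Finset.sum_insert hi, Finset.sum_insert hi, LocallyAdditive.whiskerLeft_add, ih]

theorem sum_whiskerRight {ι : Type*} (s : Finset ι) {f g : a ⟶ b} (η : ι → (f ⟶ g)) (h : b ⟶ c) :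
    (∑ i ∈ s, η i) ▷ h = ∑ i ∈ s, η i ▷ h := by
  induction s using Finset.induction_on with
  | empty => simp
  | insert i s hi ih =>
    rw [Finset.sum_insert hi, Finset.sum_insert hi, LocallyAdditive.add_whiskerRight, ih]

end

variable (B) in
/-- The additive closure of a locally preadditive bicategory `B`: the objects are those of `B`, the
1-morphisms are formal finite direct sums of 1-morphisms of `B`, and the 2-morphisms are matrices of
2-morphisms of `B`. -/
structure AddClosure : Type u where
  as : B

namespace AddClosure
set_option linter.unusedSectionVars false
variable {a b c d : B}

/-- `(⊕ f_i) ≫ (⊕ g_j) = ⊕ (f_i ≫ g_j)`. -/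
abbrev comp (f : Mat_ (a ⟶ b)) (g : Mat_ (b ⟶ c)) : Mat_ (a ⟶ c) :=
  ⟨f.ι × g.ι, fun p => f.X p.1 ≫ g.X p.2⟩

def whiskerLeft (f : Mat_ (a ⟶ b)) {g h : Mat_ (b ⟶ c)} (η : g ⟶ h) : comp f g ⟶ comp f h :=
  fun p q => if e : p.1 = q.1 then
    f.X p.1 ◁ η p.2 q.2 ≫ eqToHom (congrArg (fun i => f.X i ≫ h.X q.2) e) else 0

def whiskerRight {f g : Mat_ (a ⟶ b)} (η : f ⟶ g) (h : Mat_ (b ⟶ c)) : comp f h ⟶ comp g h :=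
  fun p q => if e : p.2 = q.2 then
    η p.1 q.1 ▷ h.X p.2 ≫ eqToHom (congrArg (fun i => g.X q.1 ≫ h.X i) e) else 0

theorem wl_same (f : Mat_ (a ⟶ b)) {g h : Mat_ (b ⟶ c)} (η : g ⟶ h) (i j j') :
    whiskerLeft f η (i, j) (i, j') = f.X i ◁ η j j' := by simp [whiskerLeft]

theorem wl_ne (f : Mat_ (a ⟶ b)) {g h : Mat_ (b ⟶ c)} (η : g ⟶ h) {i i'} (hi : i ≠ i') (j j') :
    whiskerLeft f η (i, j) (i', j') = 0 := dif_neg hi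

theorem wr_same {f g : Mat_ (a ⟶ b)} (η : f ⟶ g) (h : Mat_ (b ⟶ c)) (i i' j) :
    whiskerRight η h (i, j) (i', j) = η i i' ▷ h.X j := by simp [whiskerRight]

theorem wr_ne {f g : Mat_ (a ⟶ b)} (η : f ⟶ g) (h : Mat_ (b ⟶ c)) (i i') {j j'} (hj : j ≠ j') :
    whiskerRight η h (i, j) (i', j') = 0 := dif_neg hj

theorem wl_comp (f : Mat_ (a ⟶ b)) {g h : Mat_ (b ⟶ c)} (η : g ⟶ h) {F : Mat_ (a ⟶ c)}
    (M : comp f h ⟶ F) (i j r) :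
    (whiskerLeft f η ≫ M) (i, j) r = ∑ j', f.X i ◁ η j j' ≫ M (i, j') r := by
  rw [Mat_.comp_apply]
  refine (Fintype.sum_prod_type _).trans ?_
  rw [Finset.sum_eq_single i]
  · simp only [wl_same]
  · intro i' _ hi
    exact Finset.sum_eq_zero fun j' _ => by rw [wl_ne _ _ hi.symm, Limits.zero_comp]
  · simp

theorem wr_comp {f g : Mat_ (a ⟶ b)} (η : f ⟶ g) (h : Mat_ (b ⟶ c)) {F : Mat_ (a ⟶ c)}
    (M : comp g h ⟶ F) (i j r) :
    (whiskerRight η h ≫ M) (i, j) r = ∑ i', η i i' ▷ h.X j ≫ M (i', j) r := by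
  rw [Mat_.comp_apply]
  refine (Fintype.sum_prod_type_right _).trans ?_
  rw [Finset.sum_eq_single j]
  · simp only [wr_same]
  · intro j' _ hj
    exact Finset.sum_eq_zero fun i' _ => by rw [wr_ne _ _ _ _ hj.symm, Limits.zero_comp]
  · simp

theorem wl_reindex_comp (f : Mat_ (a ⟶ b)) {g h : Mat_ (b ⟶ c)} (e : g.ι ≃ h.ι)
    (φ : ∀ i, g.X i ≅ h.X (e i)) {F : Mat_ (a ⟶ c)} (M : comp f h ⟶ F) (i j r) :
    (whiskerLeft f (reindex e φ).hom ≫ M) (i, j) r = f.X i ◁ (φ j).hom ≫ M (i, e j) r := by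
  rw [wl_comp, Finset.sum_eq_single (e j)]
  · simp [reindex_hom_apply]
  · intro j' _ hj; rw [reindex_hom_apply, dif_neg hj.symm]; simp
  · simp

theorem wr_reindex_comp {f g : Mat_ (a ⟶ b)} (h : Mat_ (b ⟶ c)) (e : f.ι ≃ g.ι)
    (φ : ∀ i, f.X i ≅ g.X (e i)) {F : Mat_ (a ⟶ c)} (M : comp g h ⟶ F) (i j r) :
    (whiskerRight (reindex e φ).hom h ≫ M) (i, j) r = (φ i).hom ▷ h.X j ≫ M (e i, j) r := by
  rw [wr_comp, Finset.sum_eq_single (e i)]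
  · simp [reindex_hom_apply]
  · intro i' _ hi; rw [reindex_hom_apply, dif_neg hi.symm]; simp
  · simp

/-- The identity 1-morphism, as a direct sum with one summand. -/
abbrev one (a : B) : Mat_ (a ⟶ a) := ⟨Unit, fun _ => 𝟙 a⟩

def assoc (f : Mat_ (a ⟶ b)) (g : Mat_ (b ⟶ c)) (h : Mat_ (c ⟶ d)) :
    comp (comp f g) h ≅ comp f (comp g h) :=
  reindex (Equiv.prodAssoc _ _ _) fun p => α_ (f.X p.1.1) (g.X p.1.2) (h.X p.2)

def leftUnitor (f : Mat_ (a ⟶ b)) : comp (one a) f ≅ f :=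
  reindex (Equiv.punitProd f.ι) fun p => λ_ (f.X p.2)

def rightUnitor (f : Mat_ (a ⟶ b)) : comp f (one b) ≅ f :=
  reindex (Equiv.prodPUnit f.ι) fun p => ρ_ (f.X p.1)

theorem exchange {f g : Mat_ (a ⟶ b)} {h i : Mat_ (b ⟶ c)} (η : f ⟶ g) (θ : h ⟶ i) :
    whiskerLeft f θ ≫ whiskerRight η i = whiskerRight η h ≫ whiskerLeft g θ := by
  ext ⟨p, q⟩ ⟨p', q'⟩
  rw [wl_comp, wr_comp, Finset.sum_eq_single q', Finset.sum_eq_single p', wr_same, wl_same,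
    whisker_exchange]
  · intro x _ hx; rw [wl_ne _ _ hx, Limits.comp_zero]
  · simp
  · intro x _ hx; rw [wr_ne _ _ _ _ hx, Limits.comp_zero]
  · simp

theorem wl_id (f : Mat_ (a ⟶ b)) (g : Mat_ (b ⟶ c)) : whiskerLeft f (𝟙 g) = 𝟙 (comp f g) := by
  ext ⟨p, q⟩ ⟨p', q'⟩
  by_cases hp : p = p'
  · subst hp
    rw [wl_same]
    by_cases hq : q = q'
    · subst hq; rw [Mat_.id_apply_self, Mat_.id_apply_self]; exact Bicategory.whiskerLeft_id _ _
    · rw [Mat_.id_apply_of_ne _ _ _ hq, Mat_.id_apply_of_ne, whiskerLeft_zero]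
      simpa using hq
  · rw [wl_ne _ _ hp, Mat_.id_apply_of_ne]
    intro h; exact hp (congrArg Prod.fst h)

theorem wr_id (f : Mat_ (a ⟶ b)) (g : Mat_ (b ⟶ c)) : whiskerRight (𝟙 f) g = 𝟙 (comp f g) := by
  ext ⟨p, q⟩ ⟨p', q'⟩
  by_cases hq : q = q'
  · subst hq
    rw [wr_same]
    by_cases hp : p = p'
    · subst hp; rw [Mat_.id_apply_self, Mat_.id_apply_self]; exact Bicategory.id_whiskerRight _ _
    · rw [Mat_.id_apply_of_ne _ _ _ hp, Mat_.id_apply_of_ne, zero_whiskerRight]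
      simpa using hp
  · rw [wr_ne _ _ _ _ hq, Mat_.id_apply_of_ne]
    intro h; exact hq (congrArg Prod.snd h)

theorem wl_comp' (f : Mat_ (a ⟶ b)) {g h i : Mat_ (b ⟶ c)} (η : g ⟶ h) (θ : h ⟶ i) :
    whiskerLeft f (η ≫ θ) = whiskerLeft f η ≫ whiskerLeft f θ := by
  ext ⟨p, q⟩ ⟨p', q'⟩
  rw [wl_comp]
  by_cases hp : p = p'
  · subst hp
    simp only [wl_same]
    rw [Mat_.comp_apply, whiskerLeft_sum]
    simp only [Bicategory.whiskerLeft_comp]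
  · simp [wl_ne _ _ hp]

theorem wr_comp' {f g h : Mat_ (a ⟶ b)} (η : f ⟶ g) (θ : g ⟶ h) (i : Mat_ (b ⟶ c)) :
    whiskerRight (η ≫ θ) i = whiskerRight η i ≫ whiskerRight θ i := by
  ext ⟨p, q⟩ ⟨p', q'⟩
  rw [wr_comp]
  by_cases hq : q = q'
  · subst hq
    simp only [wr_same]
    rw [Mat_.comp_apply, sum_whiskerRight]
    simp only [Bicategory.comp_whiskerRight]
  · simp [wr_ne _ _ _ _ hq]

theorem id_wl {f g : Mat_ (a ⟶ b)} (η : f ⟶ g) :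
    whiskerLeft (one a) η = (leftUnitor f).hom ≫ η ≫ (leftUnitor g).inv := by
  refine reindex_conj _ _ _ _ _ _ ?_
  rintro ⟨⟨⟩, p⟩ ⟨⟨⟩, q⟩
  exact (wl_same _ _ _ _ _).trans (Bicategory.id_whiskerLeft _)

theorem wr_one {f g : Mat_ (a ⟶ b)} (η : f ⟶ g) :
    whiskerRight η (one b) = (rightUnitor f).hom ≫ η ≫ (rightUnitor g).inv := by
  refine reindex_conj _ _ _ _ _ _ ?_
  rintro ⟨p, ⟨⟩⟩ ⟨q, ⟨⟩⟩
  exact (wr_same _ _ _ _ _).trans (Bicategory.whiskerRight_id _)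

theorem comp_wl (f : Mat_ (a ⟶ b)) (g : Mat_ (b ⟶ c)) {h h' : Mat_ (c ⟶ d)} (η : h ⟶ h') :
    whiskerLeft (comp f g) η =
      (assoc f g h).hom ≫ whiskerLeft f (whiskerLeft g η) ≫ (assoc f g h').inv := by
  refine reindex_conj _ _ _ _ _ _ ?_
  rintro ⟨⟨p, q⟩, r⟩ ⟨⟨p', q'⟩, r'⟩
  change _ = _ ≫ whiskerLeft f (whiskerLeft g η) (p, (q, r)) (p', (q', r')) ≫ _
  by_cases hp : p = p'
  · subst hp
    by_cases hq : q = q'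
    · subst hq
      rw [wl_same, wl_same, wl_same]
      exact Bicategory.comp_whiskerLeft _ _ _
    · rw [wl_same, wl_ne _ _ hq, wl_ne _ _ (by simpa using hq)]; simp
  · rw [wl_ne _ _ hp, wl_ne _ _ (fun h => hp (congrArg Prod.fst h))]; simp

theorem wr_assoc {f f' : Mat_ (a ⟶ b)} (η : f ⟶ f') (g : Mat_ (b ⟶ c)) (h : Mat_ (c ⟶ d)) :
    whiskerRight (whiskerRight η g) h =
      (assoc f g h).hom ≫ whiskerRight η (comp g h) ≫ (assoc f' g h).inv := by
  refine reindex_conj _ _ _ _ _ _ ?_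
  rintro ⟨⟨p, q⟩, r⟩ ⟨⟨p', q'⟩, r'⟩
  change _ = _ ≫ whiskerRight η (comp g h) (p, (q, r)) (p', (q', r')) ≫ _
  by_cases hr : r = r'
  · subst hr
    by_cases hq : q = q'
    · subst hq
      rw [wr_same, wr_same, wr_same]
      simp
    · rw [wr_same, wr_ne _ _ _ _ hq, wr_ne _ _ _ _ (by simpa using hq)]; simp
  · rw [wr_ne _ _ _ _ hr, wr_ne _ _ _ _ (fun h => hr (congrArg Prod.snd h))]; simp

theorem wl_wr (f : Mat_ (a ⟶ b)) {g g' : Mat_ (b ⟶ c)} (η : g ⟶ g') (h : Mat_ (c ⟶ d)) :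
    whiskerRight (whiskerLeft f η) h =
      (assoc f g h).hom ≫ whiskerLeft f (whiskerRight η h) ≫ (assoc f g' h).inv := by
  refine reindex_conj _ _ _ _ _ _ ?_
  rintro ⟨⟨p, q⟩, r⟩ ⟨⟨p', q'⟩, r'⟩
  change _ = _ ≫ whiskerLeft f (whiskerRight η h) (p, (q, r)) (p', (q', r')) ≫ _
  by_cases hp : p = p'
  · subst hp
    by_cases hr : r = r'
    · subst hr
      rw [wr_same, wl_same, wl_same, wr_same]
      exact Bicategory.whisker_assoc _ _ _
    · rw [wl_same, wr_ne _ _ _ _ hr, wr_ne _ _ _ _ hr]; simp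
  · rw [wl_ne _ _ hp]
    by_cases hr : r = r'
    · subst hr; rw [wr_same, wl_ne _ _ hp]; simp
    · rw [wr_ne _ _ _ _ hr]; simp

theorem assoc_comp (f : Mat_ (a ⟶ b)) (g : Mat_ (b ⟶ c)) (h : Mat_ (c ⟶ d)) {F : Mat_ (a ⟶ d)}
    (M : comp f (comp g h) ⟶ F) (p q r t) :
    ((assoc f g h).hom ≫ M) ((p, q), r) t =
      (α_ (f.X p) (g.X q) (h.X r)).hom ≫ M (p, (q, r)) t :=
  reindex_hom_comp (F := comp (comp f g) h) (G := comp f (comp g h)) (Equiv.prodAssoc _ _ _)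
    (fun p => α_ (f.X p.1.1) (g.X p.1.2) (h.X p.2)) M ((p, q), r) t

theorem assoc_wr_comp {e : B} (f : Mat_ (a ⟶ b)) (g : Mat_ (b ⟶ c)) (h : Mat_ (c ⟶ d))
    (i : Mat_ (d ⟶ e)) {F : Mat_ (a ⟶ e)} (M : comp (comp f (comp g h)) i ⟶ F) (p q r s t) :
    (whiskerRight (assoc f g h).hom i ≫ M) (((p, q), r), s) t =
      (α_ (f.X p) (g.X q) (h.X r)).hom ▷ i.X s ≫ M ((p, (q, r)), s) t :=
  wr_reindex_comp (f := comp (comp f g) h) (g := comp f (comp g h)) i (Equiv.prodAssoc _ _ _)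
    (fun p => α_ (f.X p.1.1) (g.X p.1.2) (h.X p.2)) M ((p, q), r) s t

theorem assoc_wl_comp {e : B} (f : Mat_ (a ⟶ b)) (g : Mat_ (b ⟶ c)) (h : Mat_ (c ⟶ d))
    (i : Mat_ (d ⟶ e)) {F : Mat_ (a ⟶ e)} (M : comp f (comp g (comp h i)) ⟶ F) (p q r s t) :
    (whiskerLeft f (assoc g h i).hom ≫ M) (p, ((q, r), s)) t =
      f.X p ◁ (α_ (g.X q) (h.X r) (i.X s)).hom ≫ M (p, (q, (r, s))) t :=
  wl_reindex_comp f (g := comp (comp g h) i) (h := comp g (comp h i)) (Equiv.prodAssoc _ _ _)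
    (fun p => α_ (g.X p.1.1) (h.X p.1.2) (i.X p.2)) M p ((q, r), s) t

theorem leftUnitor_wl_comp (f : Mat_ (a ⟶ b)) (g : Mat_ (b ⟶ c)) {F : Mat_ (a ⟶ c)}
    (M : comp f g ⟶ F) (p q t) :
    (whiskerLeft f (leftUnitor g).hom ≫ M) (p, ((), q)) t =
      f.X p ◁ (λ_ (g.X q)).hom ≫ M (p, q) t :=
  wl_reindex_comp f (g := comp (one b) g) (h := g) (Equiv.punitProd g.ι)
    (fun p => λ_ (g.X p.2)) M p ((), q) t

theorem rightUnitor_wr_comp (f : Mat_ (a ⟶ b)) (g : Mat_ (b ⟶ c)) {F : Mat_ (a ⟶ c)}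
    (M : comp f g ⟶ F) (p q t) :
    (whiskerRight (rightUnitor f).hom g ≫ M) ((p, ()), q) t =
      (ρ_ (f.X p)).hom ▷ g.X q ≫ M (p, q) t :=
  wr_reindex_comp (f := comp f (one b)) (g := f) g (Equiv.prodPUnit f.ι)
    (fun p => ρ_ (f.X p.1)) M (p, ()) q t

theorem pentagon {e : B} (f : Mat_ (a ⟶ b)) (g : Mat_ (b ⟶ c)) (h : Mat_ (c ⟶ d))
    (i : Mat_ (d ⟶ e)) :
    whiskerRight (assoc f g h).hom i ≫ (assoc f (comp g h) i).hom ≫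
      whiskerLeft f (assoc g h i).hom =
    (assoc (comp f g) h i).hom ≫ (assoc f g (comp h i)).hom := by
  rw [← cancel_mono (𝟙 (comp f (comp g (comp h i))))]
  ext ⟨⟨⟨p, q⟩, r⟩, s⟩ t
  simp only [Category.assoc]
  rw [assoc_wr_comp f g h i _ p q r s t, assoc_comp f (comp g h) i _ p (q, r) s t,
    assoc_wl_comp f g h i _ p q r s t, assoc_comp (comp f g) h i _ (p, q) r s t,
    assoc_comp f g (comp h i) _ p q (r, s) t]
  exact Bicategory.pentagon_assoc (f.X p) (g.X q) (h.X r) (i.X s) _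

theorem triangle (f : Mat_ (a ⟶ b)) (g : Mat_ (b ⟶ c)) :
    (assoc f (one b) g).hom ≫ whiskerLeft f (leftUnitor g).hom =
      whiskerRight (rightUnitor f).hom g := by
  rw [← cancel_mono (𝟙 (comp f g))]
  ext ⟨⟨p, ⟨⟩⟩, q⟩ t
  simp only [Category.assoc]
  rw [rightUnitor_wr_comp f g _ p q t, assoc_comp f (one b) g _ p () q t,
    leftUnitor_wl_comp f g _ p q t]
  exact Bicategory.triangle_assoc (f.X p) (g.X q) _

theorem wr_comp_comp {f f' : Mat_ (a ⟶ b)} (η : f ⟶ f') (g : Mat_ (b ⟶ c)) (h : Mat_ (c ⟶ d)) :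
    whiskerRight η (comp g h) = (assoc f g h).inv ≫
      whiskerRight (whiskerRight η g) h ≫ (assoc f' g h).hom := by
  rw [wr_assoc, Category.assoc, Category.assoc, Iso.inv_hom_id, Category.comp_id,
    Iso.inv_hom_id_assoc]

instance : Bicategory (AddClosure B) where
  Hom a b := Mat_ (a.as ⟶ b.as)
  id a := one a.as
  comp f g := comp f g
  homCategory a b := inferInstanceAs (Category (Mat_ (a.as ⟶ b.as)))
  whiskerLeft f _ _ η := whiskerLeft f η
  whiskerRight η h := whiskerRight η h
  associator f g h := assoc f g h
  leftUnitor f := leftUnitor f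
  rightUnitor f := rightUnitor f
  whiskerLeft_id f g := wl_id f g
  whiskerLeft_comp f _ _ _ η θ := wl_comp' f η θ
  id_whiskerLeft η := id_wl η
  comp_whiskerLeft f g _ _ η := comp_wl f g η
  id_whiskerRight f g := wr_id f g
  comp_whiskerRight η θ i := wr_comp' η θ i
  whiskerRight_id η := wr_one η
  whiskerRight_comp η g h := wr_comp_comp η g h
  whisker_assoc f _ _ η h := wl_wr f η h
  whisker_exchange η θ := exchange η θ
  pentagon f g h i := pentagon f g h i
  triangle f g := triangle f g

end AddClosure
end Additive

section Single
open Bicategory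

variable {k : Type*} [Field k]

/-- The 1-morphism `E_w 1_m {shift}` from `m` to `n`. -/
@[ext]
structure Mor (χ : Params k) (m n : ℤ) where
  word : Word
  shift : ℤ
  weight : n = m + wt word

namespace Mor
variable {χ : Params k} {l m n : ℤ}

def id (n : ℤ) : Mor χ n n := ⟨[], 0, by simp [wt]⟩

/-- `E_{w'} 1_m {t'} ∘ E_w 1_l {t} = E_{w' w} 1_l {t + t'}`. -/
def comp (f : Mor χ l m) (g : Mor χ m n) : Mor χ l n :=
  ⟨g.word ++ f.word, f.shift + g.shift, by
    have := f.weight; have := g.weight; rw [wt_append]; omega⟩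

/-- The 2-morphisms from `E_w 1_m {t}` to `E_{w'} 1_m {t'}` are the linear combinations of diagrams of
degree `t - t'`, modulo the relations. -/
instance : Category (Mor χ m n) where
  Hom f g := Two.homog χ m f.word g.word (f.shift - g.shift)
  id f := ⟨Two.id χ m f.word, Two.id_mem _ (sub_self _)⟩
  comp x y := ⟨Two.comp x.1 y.1, Two.comp_mem x.2 y.2 (by ring)⟩
  id_comp _ := Subtype.ext (Two.id_comp _)
  comp_id _ := Subtype.ext (Two.comp_id _)
  assoc _ _ _ := Subtype.ext (Two.assoc _ _ _)

instance (f g : Mor χ m n) : AddCommGroup (f ⟶ g) :=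
  inferInstanceAs (AddCommGroup (Two.homog χ m f.word g.word (f.shift - g.shift)))

instance (f g : Mor χ m n) : Module k (f ⟶ g) :=
  inferInstanceAs (Module k (Two.homog χ m f.word g.word (f.shift - g.shift)))

instance preadditive : Preadditive (Mor χ m n) where
  homGroup _ _ := inferInstance
  add_comp _ _ _ x x' y := Subtype.ext (LinearMap.map_add₂ Two.comp x.1 x'.1 y.1)
  comp_add _ _ _ x y y' := Subtype.ext (map_add (Two.comp x.1) y.1 y'.1)

instance linear : Linear k (Mor χ m n) where
  smul_comp _ _ _ a x y := Subtype.ext (LinearMap.map_smul₂ Two.comp a x.1 y.1)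
  comp_smul _ _ _ x a y := Subtype.ext (map_smul (Two.comp x.1) a y.1)

/-- The 2-morphism given by the identity diagram between 1-morphisms with the same word and the same
shift. -/
def eqTo {f g : Mor χ m n} (hw : f.word = g.word) (hs : f.shift = g.shift) : f ⟶ g :=
  ⟨Two.eqTo χ m hw, Two.eqTo_mem hw (by rw [hs, sub_self])⟩

def eqToIso {f g : Mor χ m n} (hw : f.word = g.word) (hs : f.shift = g.shift) : f ≅ g where
  hom := eqTo hw hs
  inv := eqTo hw.symm hs.symm
  hom_inv_id := Subtype.ext (Two.eqTo_comp_eqTo hw hw.symm)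
  inv_hom_id := Subtype.ext (Two.eqTo_comp_eqTo hw.symm hw)

theorem comp_shift_sub_left (f : Mor χ l m) (g h : Mor χ m n) :
    g.shift - h.shift = (comp f g).shift - (comp f h).shift := by simp [comp]

theorem comp_shift_sub_right (f g : Mor χ l m) (h : Mor χ m n) :
    f.shift - g.shift = (comp f h).shift - (comp g h).shift := by simp [comp]

/-- Juxtaposition with the identity of `f` on the right in the diagram. -/
def whiskerLeft (f : Mor χ l m) {g h : Mor χ m n} (x : g ⟶ h) : comp f g ⟶ comp f h :=
  ⟨Two.padR f.word f.weight x.1,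
    comp_shift_sub_left f g h ▸ Two.padR_mem f.word f.weight x.2⟩

/-- Juxtaposition with the identity of `h` on the left in the diagram. -/
def whiskerRight {f g : Mor χ l m} (x : f ⟶ g) (h : Mor χ m n) : comp f h ⟶ comp g h :=
  ⟨Two.padL h.word x.1, comp_shift_sub_right f g h ▸ Two.padL_mem h.word x.2⟩

end Mor

/-- The 2-category with objects the integers, 1-morphisms the `E_w 1_n {t}` (no direct sums yet) and
2-morphisms the linear combinations of diagrams of the right degree, modulo the relations. -/
structure Single (χ : Params k) : Type where
  n : ℤ

instance (χ : Params k) : Bicategory (Single χ) where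
  Hom a b := Mor χ a.n b.n
  id a := Mor.id a.n
  comp f g := Mor.comp f g
  homCategory a b := inferInstanceAs (Category (Mor χ a.n b.n))
  whiskerLeft f _ _ x := Mor.whiskerLeft f x
  whiskerRight x h := Mor.whiskerRight x h
  associator f g h := Mor.eqToIso (List.append_assoc h.word g.word f.word).symm (add_assoc _ _ _)
  leftUnitor f := Mor.eqToIso (List.append_nil f.word) (zero_add _)
  rightUnitor f := Mor.eqToIso (List.nil_append f.word) (add_zero _)
  whiskerLeft_id f g := Subtype.ext (Two.padR_id _ _ _)
  whiskerLeft_comp f _ _ _ x y := Subtype.ext (Two.padR_comp _ _ _ _)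
  id_whiskerLeft x := Subtype.ext (Two.padR_nil _ _)
  comp_whiskerLeft f g _ _ x := Subtype.ext (Two.padR_append _ _ _ _ _ _)
  id_whiskerRight f g := Subtype.ext (Two.padL_id _ _)
  comp_whiskerRight x y h := Subtype.ext (Two.padL_comp _ _ _)
  whiskerRight_id {_ _ f g} x := Subtype.ext (by
    refine (Two.padL_nil x.1).trans ?_
    exact ((Two.id_comp _).trans (Two.comp_id _)).symm)
  whiskerRight_comp x g h := Subtype.ext (Two.padL_append _ _ _)
  whisker_assoc f _ _ x h := Subtype.ext (Two.padL_padR h.word f.word f.weight x.1)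
  whisker_exchange {_ _ _ f g _ _} x y := Subtype.ext (Two.exchange f.weight g.weight y.1 x.1)
  pentagon {_ _ _ _ _} f g h i := Subtype.ext (by
    refine (congrArg₂ (fun x y => Two.comp x (Two.comp (Two.eqTo χ _ _) y))
      (Two.padL_eqTo i.word _) (Two.padR_eqTo f.word f.weight _)).trans ?_
    refine (congrArg (fun x => Two.comp _ x) (Two.eqTo_comp_eqTo _ _)).trans ?_
    exact (Two.eqTo_comp_eqTo _ _).trans (Two.eqTo_comp_eqTo _ _).symm)
  triangle f g := Subtype.ext (by
    refine (congrArg (fun x => Two.comp _ x) (Two.padR_eqTo f.word f.weight _)).trans ?_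
    exact (Two.eqTo_comp_eqTo _ _).trans (Two.padL_eqTo g.word _).symm)

instance (χ : Params k) (a b : Single χ) : Preadditive (a ⟶ b) :=
  Mor.preadditive (χ := χ) (m := a.n) (n := b.n)

instance (χ : Params k) (a b : Single χ) : Linear k (a ⟶ b) :=
  Mor.linear (χ := χ) (m := a.n) (n := b.n)

instance (χ : Params k) : LocallyAdditive (Single χ) where
  whiskerLeft_add f _ _ x y := Subtype.ext (map_add (Two.padR f.word f.weight) x.1 y.1)
  add_whiskerRight x y h := Subtype.ext (map_add (Two.padL h.word) x.1 y.1)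

end Single

section TwoCategory
open Bicategory
variable {k : Type*} [Field k]

/-- The 2-category attached to the parameters `χ`: objects are the integers, 1-morphisms are formal
finite direct sums of the `E_w 1_n {t}`, 2-morphisms are matrices of linear combinations of diagrams
modulo the relations. -/
abbrev U (χ : Params k) : Type := AddClosure (Single χ)

/-- `f` itself, regarded as a 1-morphism for the parameters `χ'`. -/
def Mor.conv {χ : Params k} (χ' : Params k) {m n : ℤ} (f : Mor χ m n) : Mor χ' m n :=
  ⟨f.word, f.shift, f.weight⟩

/-- A direct sum of 1-morphisms, regarded as a 1-morphism for the parameters `χ'`. -/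
abbrev Mor.convMat {χ : Params k} (χ' : Params k) {m n : ℤ} (F : Mat_ (Mor χ m n)) :
    Mat_ (Mor χ' m n) :=
  ⟨F.ι, fun i => (F.X i).conv χ'⟩

/-- A `k`-linear strict 2-functor that is the identity on objects and on 1-morphisms `E_w 1_n {t}`. It
preserves vertical composition, identities, and composition with 1-morphisms on either side. -/
structure FunctorOverId (χ χ' : Params k) where
  map₂ : ∀ {m n : ℤ} {f g : Mor χ m n}, (f ⟶ g) →ₗ[k] (f.conv χ' ⟶ g.conv χ')
  map₂_id : ∀ {m n : ℤ} (f : Mor χ m n), map₂ (𝟙 f) = 𝟙 (f.conv χ')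
  map₂_comp : ∀ {m n : ℤ} {f g h : Mor χ m n} (x : f ⟶ g) (y : g ⟶ h),
    map₂ (x ≫ y) = map₂ x ≫ map₂ y
  map₂_whiskerLeft : ∀ {l m n : ℤ} (f : Mor χ l m) {g h : Mor χ m n} (x : g ⟶ h),
    map₂ (Mor.whiskerLeft f x) = Mor.whiskerLeft (f.conv χ') (map₂ x)
  map₂_whiskerRight : ∀ {l m n : ℤ} {f g : Mor χ l m} (x : f ⟶ g) (h : Mor χ m n),
    map₂ (Mor.whiskerRight x h) = Mor.whiskerRight (map₂ x) (h.conv χ')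

namespace FunctorOverId
variable {χ χ' : Params k} (M : FunctorOverId χ χ')

theorem map₂_eqTo {m n : ℤ} {f g : Mor χ m n} (hw : f.word = g.word) (hs : f.shift = g.shift) :
    M.map₂ (Mor.eqTo hw hs) = Mor.eqTo (f := f.conv χ') (g := g.conv χ') hw hs := by
  obtain rfl : f = g := Mor.ext hw hs
  exact M.map₂_id f

theorem map₂_eqToHom {m n : ℤ} {f g : Mor χ m n} (h : f = g) :
    M.map₂ (eqToHom h) = eqToHom (congrArg (Mor.conv χ') h) := by
  subst h; exact M.map₂_id f

/-- The action on matrices, entry by entry. -/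
def mapMat {m n : ℤ} {F G : Mat_ (Mor χ m n)} (x : F ⟶ G) :
    Mor.convMat χ' F ⟶ Mor.convMat χ' G :=
  fun i j => M.map₂ (x i j)

theorem mapMat_reindex {m n : ℤ} {F G : Mat_ (Mor χ m n)} (e : F.ι ≃ G.ι)
    (hw : ∀ i, (F.X i).word = (G.X (e i)).word) (hs : ∀ i, (F.X i).shift = (G.X (e i)).shift) :
    M.mapMat (reindex e fun i => Mor.eqToIso (hw i) (hs i)).hom =
      (reindex (F := Mor.convMat χ' F) (G := Mor.convMat χ' G) e
        fun i => Mor.eqToIso (hw i) (hs i)).hom := by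
  refine Mat_.hom_ext _ _ fun (i : F.ι) (j : G.ι) => ?_
  obtain ⟨i', rfl⟩ := e.surjective j
  by_cases h : i = i'
  · subst h
    refine (congrArg M.map₂ ((dif_pos rfl).trans (Category.comp_id _))).trans ?_
    refine (M.map₂_eqTo (hw i) (hs i)).trans ?_
    exact ((dif_pos rfl).trans (Category.comp_id _)).symm
  · have h' : e i ≠ e i' := fun h' => h (e.injective h')
    refine (congrArg M.map₂ (dif_neg h')).trans ?_
    exact (map_zero M.map₂).trans (Eq.symm (dif_neg h'))

theorem mapMat_id {m n : ℤ} (F : Mat_ (Mor χ m n)) : M.mapMat (𝟙 F) = 𝟙 (Mor.convMat χ' F) := by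
  refine Mat_.hom_ext _ _ fun (i : F.ι) (j : F.ι) => ?_
  by_cases h : i = j
  · subst h
    refine (congrArg M.map₂ (Mat_.id_apply_self F i)).trans ?_
    exact (M.map₂_id _).trans (Mat_.id_apply_self (Mor.convMat χ' F) i).symm
  · refine (congrArg M.map₂ (Mat_.id_apply_of_ne F i j h)).trans ?_
    exact (map_zero M.map₂).trans (Mat_.id_apply_of_ne (Mor.convMat χ' F) i j h).symm

theorem mapMat_comp {m n : ℤ} {F G H : Mat_ (Mor χ m n)} (x : F ⟶ G) (y : G ⟶ H) :
    M.mapMat (x ≫ y) = M.mapMat x ≫ M.mapMat y := by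
  refine Mat_.hom_ext _ _ fun (i : F.ι) (j : H.ι) => ?_
  refine (congrArg M.map₂ (Mat_.comp_apply x y i j)).trans ?_
  refine (map_sum M.map₂ _ _).trans ?_
  exact (Finset.sum_congr rfl fun _ _ => M.map₂_comp _ _).trans
    (Mat_.comp_apply (M.mapMat x) (M.mapMat y) i j).symm

theorem mapMat_whiskerLeft {l m n : ℤ} (F : Mat_ (Mor χ l m)) {G H : Mat_ (Mor χ m n)}
    (x : G ⟶ H) :
    M.mapMat (AddClosure.whiskerLeft (B := Single χ) (a := ⟨l⟩) (b := ⟨m⟩) (c := ⟨n⟩) F x) =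
      AddClosure.whiskerLeft (B := Single χ') (a := ⟨l⟩) (b := ⟨m⟩) (c := ⟨n⟩)
        (Mor.convMat χ' F) (M.mapMat x) := by
  refine Mat_.hom_ext _ _ fun (i : F.ι × G.ι) (j : F.ι × H.ι) => ?_
  obtain ⟨p, q⟩ := i
  obtain ⟨p', q'⟩ := j
  by_cases h : p = p'
  · subst h
    refine (congrArg M.map₂ (AddClosure.wl_same (B := Single χ) (a := ⟨l⟩) (b := ⟨m⟩) (c := ⟨n⟩)
      F x p q q')).trans ?_
    exact (M.map₂_whiskerLeft _ _).trans (AddClosure.wl_same (B := Single χ') (a := ⟨l⟩)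
      (b := ⟨m⟩) (c := ⟨n⟩) (Mor.convMat χ' F) (M.mapMat x) p q q').symm
  · refine (congrArg M.map₂ (AddClosure.wl_ne (B := Single χ) (a := ⟨l⟩) (b := ⟨m⟩) (c := ⟨n⟩)
      F x h q q')).trans ?_
    exact (map_zero M.map₂).trans (AddClosure.wl_ne (B := Single χ') (a := ⟨l⟩)
      (b := ⟨m⟩) (c := ⟨n⟩) (Mor.convMat χ' F) (M.mapMat x) h q q').symm

theorem mapMat_whiskerRight {l m n : ℤ} {F G : Mat_ (Mor χ l m)} (x : F ⟶ G)
    (H : Mat_ (Mor χ m n)) :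
    M.mapMat (AddClosure.whiskerRight (B := Single χ) (a := ⟨l⟩) (b := ⟨m⟩) (c := ⟨n⟩) x H) =
      AddClosure.whiskerRight (B := Single χ') (a := ⟨l⟩) (b := ⟨m⟩) (c := ⟨n⟩)
        (M.mapMat x) (Mor.convMat χ' H) := by
  refine Mat_.hom_ext _ _ fun (i : F.ι × H.ι) (j : G.ι × H.ι) => ?_
  obtain ⟨p, q⟩ := i
  obtain ⟨p', q'⟩ := j
  by_cases h : q = q'
  · subst h
    refine (congrArg M.map₂ (AddClosure.wr_same (B := Single χ) (a := ⟨l⟩) (b := ⟨m⟩) (c := ⟨n⟩)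
      x H p p' q)).trans ?_
    exact (M.map₂_whiskerRight _ _).trans (AddClosure.wr_same (B := Single χ') (a := ⟨l⟩)
      (b := ⟨m⟩) (c := ⟨n⟩) (M.mapMat x) (Mor.convMat χ' H) p p' q).symm
  · refine (congrArg M.map₂ (AddClosure.wr_ne (B := Single χ) (a := ⟨l⟩) (b := ⟨m⟩) (c := ⟨n⟩)
      x H p p' h)).trans ?_
    exact (map_zero M.map₂).trans (AddClosure.wr_ne (B := Single χ') (a := ⟨l⟩)
      (b := ⟨m⟩) (c := ⟨n⟩) (M.mapMat x) (Mor.convMat χ' H) p p' h).symm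

theorem eq_eqToHom_comp {C : Type*} [Category C] {A A' B B' : C} (h : A = A') (h' : B' = B)
    {x : A ⟶ B} {y : A' ⟶ B'} (hxy : HEq x y) : x = eqToHom h ≫ y ≫ eqToHom h' := by
  subst h; subst h'; simpa using hxy

theorem eq_eqToHom_comp' {C : Type*} [Category C] {A A' B : C} (h : A = A')
    {x : A ⟶ B} {y : A' ⟶ B} (hxy : HEq x y) : x = eqToHom h ≫ y := by
  subst h; simpa using hxy

/-- The induced strict 2-functor, which is the identity on objects and on formal direct sums of
1-morphisms, and acts on matrices of 2-morphisms entry by entry. -/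
def toStrictPseudofunctor : StrictPseudofunctor (U χ) (U χ') :=
  StrictPseudofunctor.mk'
    { obj := fun a => ⟨⟨a.as.n⟩⟩
      map := fun {a b} (F : Mat_ (Mor χ a.as.n b.as.n)) => Mor.convMat χ' F
      map₂ := fun {_ _ _ _} x => M.mapMat x
      map₂_id := fun F => M.mapMat_id F
      map₂_comp := fun x y => M.mapMat_comp x y
      map_id := fun _ => rfl
      map_comp := fun _ _ => rfl
      map₂_whisker_left := fun F _ _ x =>
        eq_eqToHom_comp _ _ (heq_of_eq (M.mapMat_whiskerLeft F x))
      map₂_whisker_right := fun x F =>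
        eq_eqToHom_comp _ _ (heq_of_eq (M.mapMat_whiskerRight x F))
      map₂_left_unitor := fun _ =>
        eq_eqToHom_comp' _ (heq_of_eq (M.mapMat_reindex _ _ _))
      map₂_right_unitor := fun _ =>
        eq_eqToHom_comp' _ (heq_of_eq (M.mapMat_reindex _ _ _))
      map₂_associator := fun _ _ _ =>
        eq_eqToHom_comp _ _ (heq_of_eq (M.mapMat_reindex _ _ _)) }

end FunctorOverId
theorem Gen.wt_eq {w w' : Word} (g : Gen w w') : wt w = wt w' := by
  cases g <;> simp [wt]

namespace Two
variable (χ : Params k) {m n : ℤ}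

theorem ofLin_gen_mem (n : ℤ) {w w' : Word} (g : Gen w w') :
    ofLin χ (Lin.gen k n g) ∈ homog χ n w w' (g.deg n) := diag_mem _ rfl

theorem ofLin_id_mem (n : ℤ) (w : Word) : ofLin χ (Lin.id k n w) ∈ homog χ n w w 0 :=
  id_mem w rfl

theorem dots_mem (n : ℤ) (a : ℕ) : ofLin χ (dots k n a) ∈ homog χ n [E] [E] (2 * a) := by
  induction a with
  | zero => exact ofLin_id_mem χ n [E]
  | succ a ih =>
    exact comp_mem ih (ofLin_gen_mem χ n .dotUp) (by simp only [Gen.deg]; push_cast; ring)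

theorem cwReal_mem (n : ℤ) (a : ℕ) :
    ofLin χ (cwReal k n a) ∈ homog χ n [] [] (2 * (1 - n + a)) :=
  comp_mem (comp_mem (ofLin_gen_mem χ n .cupEF) (padR_mem [F] rfl (dots_mem χ _ a)) rfl)
    (ofLin_gen_mem χ n .capEF) (by simp only [Gen.deg]; ring)

theorem ccwReal_mem (n : ℤ) (a : ℕ) :
    ofLin χ (ccwReal k n a) ∈ homog χ n [] [] (2 * (1 + n + a)) :=
  comp_mem (comp_mem (ofLin_gen_mem χ n .cupFE) (padL_mem [F] (dots_mem χ _ a)) rfl)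
    (ofLin_gen_mem χ n .capFE) (by simp only [Gen.deg]; ring)

theorem prodBub_mem (f : ℕ → Lin k n [] [])
    (hf : ∀ i : ℕ, 0 < i → ofLin χ (f i) ∈ homog χ n [] [] (2 * i)) (l : List ℕ)
    (hl : ∀ i ∈ l, 0 < i) : ofLin χ (prodBub f l) ∈ homog χ n [] [] (2 * l.sum) := by
  induction l with
  | nil => exact ofLin_id_mem χ n []
  | cons i l ih =>
    exact comp_mem (hf i (hl i (by simp))) (ih fun j hj => hl j (by simp [hj]))
      (by simp; ring)

theorem fakeSum_mem (c : kˣ) (f : ℕ → Lin k n [] [])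
    (hf : ∀ i : ℕ, 0 < i → ofLin χ (f i) ∈ homog χ n [] [] (2 * i)) (j : ℕ) :
    ofLin χ (fakeSum c f j) ∈ homog χ n [] [] (2 * j) := by
  rw [fakeSum, map_sum]
  refine Submodule.sum_mem _ fun l _ => ?_
  rw [map_smul]
  refine Submodule.smul_mem _ _ ?_
  have := prodBub_mem χ f hf (l.parts.sort (· ≥ ·)) fun i hi =>
    l.parts_pos ((Multiset.mem_sort _).1 hi)
  rwa [← Multiset.sum_coe, Multiset.sort_eq, l.parts_sum] at this

theorem cw_mem (n : ℤ) (j : ℕ) : ofLin χ (cw χ n j) ∈ homog χ n [] [] (2 * j) := by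
  unfold cw
  split_ifs with h h'
  · rw [map_smul]
    refine Submodule.smul_mem _ _ (fakeSum_mem χ _ _ (fun i hi => ?_) j)
    have := ccwReal_mem χ n (-n - 1 + i).toNat
    rwa [show 1 + n + ((-n - 1 + i).toNat : ℤ) = i by omega] at this
  · rw [map_smul, h'.2]
    exact Submodule.smul_mem _ _ (ofLin_id_mem χ n [])
  · have := cwReal_mem χ n (n - 1 + j).toNat
    rwa [show 1 - n + ((n - 1 + j).toNat : ℤ) = j by omega] at this

theorem ccw_mem (n : ℤ) (j : ℕ) : ofLin χ (ccw χ n j) ∈ homog χ n [] [] (2 * j) := by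
  unfold ccw
  split_ifs with h h'
  · rw [map_smul]
    refine Submodule.smul_mem _ _ (fakeSum_mem χ _ _ (fun i hi => ?_) j)
    have := cwReal_mem χ n (n - 1 + i).toNat
    rwa [show 1 - n + ((n - 1 + i).toNat : ℤ) = i by omega] at this
  · rw [map_smul, h'.2]
    exact Submodule.smul_mem _ _ (ofLin_id_mem χ n [])
  · have := ccwReal_mem χ n (-n - 1 + j).toNat
    rwa [show 1 + n + ((-n - 1 + j).toNat : ℤ) = j by omega] at this

end Two

section Generators
variable (χ : Params k)

/-- The 1-morphism `1_n {t}`. -/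
def Mor.unit (n t : ℤ) : Mor χ n n := ⟨[], t, by simp [wt]⟩

/-- A combination of diagrams of the right degree, as a 2-morphism. -/
def Mor.ofTwo {m n : ℤ} {f g : Mor χ m n} (x : Two χ m f.word g.word) {d : ℤ}
    (hx : x ∈ Two.homog χ m f.word g.word d) (hd : d = f.shift - g.shift) : f ⟶ g :=
  ⟨x, hd ▸ hx⟩

/-- A generator in the region `n`, as a 2-morphism `E_w 1_n {t + deg} → E_{w'} 1_n {t}`. -/
def genMor (n t : ℤ) {w w' : Word} (g : Gen w w') :
    (⟨w, t + g.deg n, rfl⟩ : Mor χ n (n + wt w)) ⟶ ⟨w', t, by rw [g.wt_eq]⟩ :=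
  Mor.ofTwo χ (Two.ofLin χ (Lin.gen k n g)) (Two.ofLin_gen_mem χ n g) (by simp)

/-- The clockwise bubble of degree `2 j` (real or fake) as a 2-morphism `1_n {t + 2 j} → 1_n {t}`. -/
def cwMor (n t : ℤ) (j : ℕ) : Mor.unit χ n (t + 2 * j) ⟶ Mor.unit χ n t :=
  Mor.ofTwo χ (Two.ofLin χ (cw χ n j)) (Two.cw_mem χ n j) (by simp [Mor.unit])

/-- The counterclockwise bubble of degree `2 j` (real or fake) as a 2-morphism
`1_n {t + 2 j} → 1_n {t}`. -/
def ccwMor (n t : ℤ) (j : ℕ) : Mor.unit χ n (t + 2 * j) ⟶ Mor.unit χ n t :=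
  Mor.ofTwo χ (Two.ofLin χ (ccw χ n j)) (Two.ccw_mem χ n j) (by simp [Mor.unit])

/-- The factor of the cap `E F → 1`. The first case is `n = 2 ℓ` or `n = 2 ℓ + 1`, the second one is
`n = -2 ℓ` or `n = -(2 ℓ + 3)`, with `ℓ ≥ 0` even. -/
def capEFFactor (n : ℤ) : kˣ :=
  if 0 ≤ n ∧ (n % 4 = 0 ∨ n % 4 = 1) then (χ.cp n)⁻¹
  else if n ≤ 0 ∧ (-n % 4 = 0 ∨ -n % 4 = 3) then χ.cm (n - 2)
  else 1

/-- The factor of the cap `F E → 1`; the cases are the same as for `E F → 1`. -/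
def capFEFactor (n : ℤ) : kˣ :=
  if 0 ≤ n ∧ (n % 4 = 0 ∨ n % 4 = 1) then χ.cp (n + 2)
  else if n ≤ 0 ∧ (-n % 4 = 0 ∨ -n % 4 = 3) then (χ.cm n)⁻¹
  else 1

/-- The factor of the cup `1 → E F`. The first case is `n = 2 ℓ + 2` or `n = 2 ℓ + 3`, the second one is
`n = -(2 ℓ + 1)` or `n = -(2 ℓ + 2)`, with `ℓ ≥ 0` even. -/
def cupEFFactor (n : ℤ) : kˣ :=
  if 0 ≤ n ∧ (n % 4 = 2 ∨ n % 4 = 3) then (χ.cp n)⁻¹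
  else if n ≤ 0 ∧ (-n % 4 = 1 ∨ -n % 4 = 2) then χ.cm (n - 2)
  else 1

/-- The factor of the cup `1 → F E`; the cases are the same as for `1 → E F`. -/
def cupFEFactor (n : ℤ) : kˣ :=
  if 0 ≤ n ∧ (n % 4 = 2 ∨ n % 4 = 3) then χ.cp (n + 2)
  else if n ≤ 0 ∧ (-n % 4 = 1 ∨ -n % 4 = 2) then (χ.cm n)⁻¹
  else 1

/-- The factor by which each generator in the region `n` is rescaled. -/
def rescale (n : ℤ) : ∀ {w w' : Word}, Gen w w' → kˣ
  | _, _, .capEF => capEFFactor χ n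
  | _, _, .capFE => capFEFactor χ n
  | _, _, .cupEF => cupEFFactor χ n
  | _, _, .cupFE => cupFEFactor χ n
  | _, _, .dotUp => 1
  | _, _, .dotDown => 1
  | _, _, .crossUp => 1
  | _, _, .crossDown => 1

/-- The factor of a clockwise bubble in the region `n`. -/
def cwFactor (n : ℤ) : kˣ := if 0 ≤ n then (χ.cp n)⁻¹ else -(χ.β n * χ.cm n)

/-- The factor of a counterclockwise bubble in the region `n`. -/
def ccwFactor (n : ℤ) : kˣ := if n ≤ 0 then (χ.cm n)⁻¹ else -(χ.β n * χ.cp n)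

end Generators
end TwoCategory
end CatSl2
end

noncomputable section
namespace CatSl2

/-! The isomorphism is diagonal in the basis of string diagrams. Choose a unit for every generator
in every region and multiply each diagram by the product of the units of its generators. The
identifications of a strict 2-category never change which generators occur in which regions, so this
is a well-defined linear automorphism of the free 2-category (`TwoCatRel.scale_eq`). It descends to
a map from the quotient for `χ` to the quotient for `χ'` as soon as every defining relation for `χ`
becomes a scalar multiple of the corresponding relation for `χ'`.

Write p and q for the products of cup and cap scalars in a clockwise and a counterclockwise bubble
in region n. Zigzags and cyclicity force the cup and cap in adjacent regions to cancel; dots and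
crossings keep the scalar 1. The degree-zero bubbles fix p for n ≥ 0 and q for n ≤ 0. The
decompositions of EF and FE require β' = p q β. The curls then hold automatically, provided that
fake bubbles scale by p and q as real ones do. This is a homogeneity statement: if all e_i,
including e_0, are multiplied by q, the inverse power series is multiplied by 1/q (`fakeSum_smul`),
and the prefactor 1/β turns 1/q into p. These conditions are collected in `IsRescaling`, and
`IsRescaling.inIdeal_of_rel` checks the relations one by one.

The inverse units satisfy the same conditions with `χ` and `χ'` exchanged, which yields the strict
inverse. It remains to see that the prescribed factors satisfy the conditions
(`isRescaling_rescale`). They follow a pattern modulo 4: caps may be rescaled only in regions n ≡ 0,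
1, cups only in regions n ≡ 2, 3. Hence in a bubble at most one of the cup and the cap is rescaled,
while in a zigzag, whose cup and cap lie in regions two apart, either both or neither can be. The
recursions for c_n^± give the values of p and q; the two conditions linking c^+ and c^- are used
where positive and negative regions meet. -/

/-- A scalar for each generating 2-morphism in each region. -/
abbrev GenScale (k : Type*) [Field k] := ∀ _ : ℤ, ∀ ⦃w w' : Word⦄, Gen w w' → kˣ

/-! ### Rescaling of string diagrams by scalars attached to the generators -/

section Scale
variable {k : Type*} [Field k] (s : GenScale k)

/-- The product of the scalars of all generators of a diagram. -/
def Pre.scale : ∀ {n : ℤ} {w w' : Word}, Pre n w w' → kˣ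
  | n, _, _, .gen _ g => s n g
  | _, _, _, .id _ _ => 1
  | _, _, _, .comp x y => x.scale * y.scale
  | _, _, _, .padL _ x => x.scale
  | _, _, _, .padR _ _ x => x.scale

theorem Pre.scale_eqTo (n : ℤ) {w w' : Word} (h : w = w') : (Pre.eqTo n h).scale s = 1 := by
  subst h; rfl

/-- Both sides of every identification contain the same generators in the same regions, up to
identities and reordering, and the group of units is commutative. -/
theorem TwoCatRel.scale_eq {n : ℤ} {w w' : Word} {x y : Pre n w w'} (h : TwoCatRel x y) :
    x.scale s = y.scale s := by
  induction h <;> simp_all [Pre.scale, Pre.scale_eqTo, mul_assoc, mul_comm]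

def Diag.scale {n : ℤ} {w w' : Word} (x : Diag n w w') : kˣ :=
  Quot.lift (Pre.scale s) (fun _ _ h => h.scale_eq s) x

namespace Diag
variable {m n : ℤ}

theorem scale_comp {w w' w'' : Word} (x : Diag n w w') (y : Diag n w' w'') :
    (comp x y).scale s = x.scale s * y.scale s := by
  induction x using Quot.ind; induction y using Quot.ind; rfl

theorem scale_padL (u : Word) {w w' : Word} (x : Diag n w w') :
    (padL u x).scale s = x.scale s := by
  induction x using Quot.ind; rfl

theorem scale_padR (v : Word) (h : m = n + wt v) {w w' : Word} (x : Diag m w w') :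
    (padR v h x).scale s = x.scale s := by
  induction x using Quot.ind; rfl

theorem scale_inv {w w' : Word} (x : Diag n w w') :
    x.scale (fun n _ _ g => (s n g)⁻¹) = (x.scale s)⁻¹ := by
  induction x using Quot.ind with
  | _ x =>
    change Pre.scale _ x = (Pre.scale s x)⁻¹
    induction x <;> simp_all [Pre.scale, mul_comm]

end Diag

namespace Lin
variable {m n : ℤ}

/-- The linear map that multiplies each diagram by the scalars of its generators. -/
def scale {n : ℤ} {w w' : Word} : Lin k n w w' →ₗ[k] Lin k n w w' :=
  Finsupp.lift _ k _ fun x => Finsupp.single x (x.scale s).val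

@[simp] theorem scale_single {w w' : Word} (x : Diag n w w') (a : k) :
    scale s (Finsupp.single x a) = Finsupp.single x (a * (x.scale s).val) := by
  simp [scale]

@[simp] theorem scale_gen {w w' : Word} (g : Gen w w') :
    scale s (gen k n g) = (s n g).val • gen k n g := by
  rw [gen, scale_single, Finsupp.smul_single', one_mul, mul_one]; rfl

@[simp] theorem scale_id (w : Word) : scale s (id k n w) = id k n w := by
  rw [id, scale_single, one_mul]; rfl

@[simp] theorem scale_comp {w w' w'' : Word} (x : Lin k n w w') (y : Lin k n w' w'') :
    scale s (comp x y) = comp (scale s x) (scale s y) := by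
  induction x using Finsupp.induction_linear with
  | zero => simp
  | add x x' hx hx' => simp [hx, hx']
  | single D a =>
    induction y using Finsupp.induction_linear with
    | zero => simp
    | add y y' hy hy' => simp [hy, hy']
    | single D' b => simp [Diag.scale_comp, mul_mul_mul_comm, -Finsupp.single_mul]

@[simp] theorem scale_padL (u : Word) {w w' : Word} (x : Lin k n w w') :
    scale s (padL u x) = padL u (scale s x) := by
  induction x using Finsupp.induction_linear with
  | zero => simp
  | add x x' hx hx' => simp [hx, hx']
  | single D a => simp [Diag.scale_padL, -Finsupp.single_mul]

@[simp] theorem scale_padR (v : Word) (h : m = n + wt v) {w w' : Word} (x : Lin k m w w') :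
    scale s (padR v h x) = padR v h (scale s x) := by
  induction x using Finsupp.induction_linear with
  | zero => simp
  | add x x' hx hx' => simp [hx, hx']
  | single D a => simp [Diag.scale_padR, -Finsupp.single_mul]

theorem scale_inv_scale {w w' : Word} (x : Lin k n w w') :
    scale (fun n _ _ g => (s n g)⁻¹) (scale s x) = x := by
  induction x using Finsupp.induction_linear with
  | zero => simp
  | add x x' hx hx' => simp [hx, hx']
  | single D a => simp [Diag.scale_inv, -Finsupp.single_mul]

end Lin

/-! ### Homogeneity of the coefficients in the fake bubbles -/

section Alpha

/-- Each step of the recursion multiplies by one variable and by one factor 1/c, and the recursion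
starts at 1/c. So a monomial of degree d carries exactly d + 1 factors 1/c, whatever its weighted
degree j. -/
theorem coeff_alphaPoly (c : kˣ) (j : ℕ) (m : ℕ →₀ ℕ) :
    (alphaPoly c j).coeff m = (c⁻¹ : kˣ).val ^ (m.degree + 1) * (alphaPoly (1 : kˣ) j).coeff m := by
  induction j using Nat.strong_induction_on generalizing m with
  | _ j ih =>
    cases j with
    | zero =>
      simp only [alphaPoly, inv_one, MvPolynomial.coeff_C]
      split_ifs with h
      · subst h; simp
      · simp
    | succ t =>
      simp only [alphaPoly, ← map_neg, MvPolynomial.coeff_C_mul, MvPolynomial.coeff_sum,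
        MvPolynomial.coeff_mul_X', Finset.mul_sum]
      refine Finset.sum_congr rfl fun r _ => ?_
      split_ifs with h
      · rw [ih (t - r) (by omega)]
        -- The variable split off by the recursion accounts for exactly one unit of degree, matching
        -- the factor 1/c of that step.
        have : m.degree = (m - Finsupp.single (r + 1 : ℕ) 1).degree + 1 := by
          conv_lhs => rw [← tsub_add_cancel_of_le (b := m) (a := Finsupp.single (r + 1 : ℕ) 1)
            (by simpa [Finsupp.single_le_iff, Nat.one_le_iff_ne_zero] using h)]
          simp
        rw [this]
        simp only [inv_one, Units.val_one]
        ring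
      · simp

theorem degree_toFinsupp (t : Multiset ℕ) : (Multiset.toFinsupp t).degree = t.card := by
  induction t using Multiset.induction_on with
  | empty => simp
  | cons a t ih =>
    rw [← Multiset.singleton_add, map_add, map_add, ih]
    simp [add_comm]

/-- The monomial of a partition with m parts has degree m, so its coefficient at e_0 = q c contains
q^{-(m+1)}. Scaling the m variables by q cancels all but one of these factors. -/
theorem alpha_mul (c q : kˣ) {j : ℕ} (l : Nat.Partition j) :
    alpha (q * c) l * (q.val ^ l.parts.card) = (q⁻¹).val * alpha c l := by
  rw [alpha, alpha, coeff_alphaPoly, coeff_alphaPoly c, degree_toFinsupp, mul_inv, Units.val_mul,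
    mul_pow, pow_succ (q⁻¹).val]
  have : (q⁻¹).val ^ l.parts.card * q.val ^ l.parts.card = 1 := by
    rw [← mul_pow]; simp
  linear_combination ((q⁻¹).val * (c⁻¹).val ^ (l.parts.card + 1) *
    MvPolynomial.coeff (Multiset.toFinsupp l.parts) (alphaPoly 1 j)) * this

theorem prodBub_smul {n : ℤ} (q : k) (f : ℕ → Lin k n [] []) (l : List ℕ) :
    prodBub (fun i => q • f i) l = q ^ l.length • prodBub f l := by
  induction l with
  | nil => simp [prodBub]
  | cons i l ih => simp [prodBub, ih, smul_smul, pow_succ, mul_comm]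

/-- The inverse of a power series multiplied by q is the inverse series divided by q. The parameter
`c` plays the role of the degree-zero bubble and must therefore scale together with the `f i`. -/
theorem fakeSum_smul {n : ℤ} (c q : kˣ) (f : ℕ → Lin k n [] []) (j : ℕ) :
    fakeSum (q * c) (fun i => q.val • f i) j = (q⁻¹).val • fakeSum c f j := by
  simp only [fakeSum, prodBub_smul, Finset.smul_sum, smul_smul]
  refine Finset.sum_congr rfl fun l _ => ?_
  rw [← alpha_mul c q l]; simp

theorem scale_prodBub {n : ℤ} (f : ℕ → Lin k n [] []) (l : List ℕ) :
    Lin.scale s (prodBub f l) = prodBub (fun i => Lin.scale s (f i)) l := by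
  induction l with
  | nil => simp [prodBub]
  | cons i l ih => simp [prodBub, ih]

theorem scale_fakeSum {n : ℤ} (c : kˣ) (f : ℕ → Lin k n [] []) (j : ℕ) :
    Lin.scale s (fakeSum c f j) = fakeSum c (fun i => Lin.scale s (f i)) j := by
  simp [fakeSum, scale_prodBub]

end Alpha
end Scale

open Letter

/-! ### Calculus of rescaling factors, and compatibility with the defining relations -/

section Rescaling
variable {k : Type*} [Field k]

/-- Rescaling the generators by `s` turns `x` into `c` times `x'`. -/
def Scales (s : GenScale k) {n : ℤ} {w w' : Word} (x x' : Lin k n w w') (c : kˣ) : Prop :=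
  Lin.scale s x = c.val • x'

namespace Scales
variable {s : GenScale k} {m n : ℤ}

theorem gen {w w' : Word} (g : Gen w w') : Scales s (Lin.gen k n g) (Lin.gen k n g) (s n g) :=
  Lin.scale_gen s g

theorem id (w : Word) : Scales s (Lin.id k n w) (Lin.id k n w) 1 := by
  simp [Scales]

theorem zero (w w' : Word) (c : kˣ) : Scales s (0 : Lin k n w w') 0 c := by
  simp [Scales]

theorem comp {w w' w'' : Word} {x x' : Lin k n w w'} {y y' : Lin k n w' w''} {c d : kˣ}
    (hx : Scales s x x' c) (hy : Scales s y y' d) :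
    Scales s (Lin.comp x y) (Lin.comp x' y') (c * d) := by
  rw [Scales, Lin.scale_comp, hx, hy]
  simp [smul_smul, mul_comm]

theorem padL (u : Word) {w w' : Word} {x x' : Lin k n w w'} {c : kˣ} (hx : Scales s x x' c) :
    Scales s (Lin.padL u x) (Lin.padL u x') c := by
  rw [Scales, Lin.scale_padL, hx, map_smul]

theorem padR (v : Word) (h : m = n + wt v) {w w' : Word} {x x' : Lin k m w w'} {c : kˣ}
    (hx : Scales s x x' c) : Scales s (Lin.padR v h x) (Lin.padR v h x') c := by
  rw [Scales, Lin.scale_padR, hx, map_smul]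

theorem sub {w w' : Word} {x x' y y' : Lin k n w w'} {c : kˣ} (hx : Scales s x x' c)
    (hy : Scales s y y' c) : Scales s (x - y) (x' - y') c := by
  rw [Scales, map_sub, hx, hy, smul_sub]

theorem neg {w w' : Word} {x x' : Lin k n w w'} {c : kˣ} (hx : Scales s x x' c) :
    Scales s (-x) (-x') c := by
  rw [Scales, map_neg, hx, smul_neg]

theorem sum {w w' : Word} {ι : Type*} {t : Finset ι} {x x' : ι → Lin k n w w'} {c : kˣ}
    (hx : ∀ i, Scales s (x i) (x' i) c) : Scales s (∑ i ∈ t, x i) (∑ i ∈ t, x' i) c := by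
  rw [Scales, map_sum, Finset.smul_sum]
  exact Finset.sum_congr rfl fun i _ => hx i

/-- The coefficients `a` and `a'` may differ because the relations for `χ` and for `χ'` contain
different values of β and c; the hypothesis says how the factor absorbs the difference. -/
theorem smul {w w' : Word} {x x' : Lin k n w w'} {a a' c d : kˣ} (hx : Scales s x x' c)
    (h : a * c = d * a') : Scales s (a.val • x) (a'.val • x') d := by
  rw [Scales, map_smul, hx, smul_smul, smul_smul, ← Units.val_mul, h, Units.val_mul]

theorem of_eq {w w' : Word} {x x' : Lin k n w w'} {c d : kˣ} (hx : Scales s x x' c)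
    (h : c = d) : Scales s x x' d := h ▸ hx

/-- If both sides of a relation acquire the same factor, their difference becomes a multiple of the
corresponding relation for `χ'`. This is how each relation is transported. -/
theorem inIdeal {χ' : Params k} {w w' : Word} {x x' y y' : Lin k n w w'} {c d : kˣ}
    (hx : Scales s x x' c) (hy : Scales s y y' d) (h : c = d) (hr : Rel k χ' x' y') :
    InIdeal χ' (Lin.scale s x - Lin.scale s y) := by
  subst h
  rw [hx, hy, ← smul_sub]
  exact .smul _ (.rel hr)

/-- The sum formed from bubbles with factor `q` has factor `q⁻¹`, provided that the constant terms
`c` and `c'` are related by the same `q`. -/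
theorem fakeSum {n : ℤ} {f f' : ℕ → Lin k n [] []} {q c c' : kˣ}
    (hf : ∀ i, Scales s (f i) (f' i) q) (hc : q * c' = c) (j : ℕ) :
    Scales s (CatSl2.fakeSum c f j) (CatSl2.fakeSum c' f' j) q⁻¹ := by
  subst hc
  rw [Scales, scale_fakeSum, ← fakeSum_smul]
  exact congrArg (CatSl2.fakeSum _ · j) (funext hf)

end Scales

/-- The conditions under which rescaling the generators by `s` turns the relations for the
parameters `χ` into those for `χ'`. -/
structure IsRescaling (χ χ' : Params k) (s : GenScale k) : Prop where
  dotUp : ∀ n, s n .dotUp = 1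
  dotDown : ∀ n, s n .dotDown = 1
  crossUp : ∀ n, s n .crossUp = 1
  crossDown : ∀ n, s n .crossDown = 1
  cupEF_capFE : ∀ n, s (n + 2) .cupEF * s n .capFE = 1
  cupFE_capEF : ∀ n, s n .cupFE * s (n + 2) .capEF = 1
  cw_cp : ∀ n, 0 ≤ n → s n .cupEF * s n .capEF * χ'.cp n = χ.cp n
  ccw_cm : ∀ n, n ≤ 0 → s n .cupFE * s n .capFE * χ'.cm n = χ.cm n
  β : ∀ n, s n .cupEF * s n .capEF * (s n .cupFE * s n .capFE) * χ.β n = χ'.β n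

/-- Every condition is multiplicative in the scalars and the parameters, so it can be solved for the
parameters of `χ`. This provides the candidate for the inverse 2-functor. -/
theorem IsRescaling.inv {χ χ' : Params k} {s : GenScale k} (h : IsRescaling χ χ' s) :
    IsRescaling χ' χ (fun n _ _ g => (s n g)⁻¹) where
  dotUp n := by simp [h.dotUp]
  dotDown n := by simp [h.dotDown]
  crossUp n := by simp [h.crossUp]
  crossDown n := by simp [h.crossDown]
  cupEF_capFE n := by rw [← mul_inv, h.cupEF_capFE, inv_one]
  cupFE_capEF n := by rw [← mul_inv, h.cupFE_capEF, inv_one]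
  cw_cp n hn := by rw [← h.cw_cp n hn, ← mul_inv, inv_mul_cancel_left]
  ccw_cm n hn := by rw [← h.ccw_cm n hn, ← mul_inv, inv_mul_cancel_left]
  β n := by rw [← h.β n, ← mul_inv, ← mul_inv, ← mul_inv, inv_mul_cancel_left]

/-! ### Factors of the composite diagrams, and the check of each relation -/

namespace IsRescaling
variable {χ χ' : Params k} {s : GenScale k}

theorem scales_gen_one {n : ℤ} {w w' : Word} {g : Gen w w'} (hg : s n g = 1) :
    Scales s (Lin.gen k n g) (Lin.gen k n g) 1 :=
  (Scales.gen g).of_eq hg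

theorem scales_dots (h : IsRescaling χ χ' s) (n : ℤ) (a : ℕ) :
    Scales s (dots k n a) (dots k n a) 1 := by
  induction a with
  | zero => exact .id _
  | succ a ih => exact (ih.comp (scales_gen_one (h.dotUp n))).of_eq (one_mul _)

theorem scales_cupEF (h : IsRescaling χ χ' s) (n : ℤ) (a : ℕ) :
    Scales s (cupEF k n a) (cupEF k n a) (s n .cupEF) :=
  ((Scales.gen .cupEF).comp (.padR _ _ (h.scales_dots _ a))).of_eq (mul_one _)

theorem scales_cupFE (h : IsRescaling χ χ' s) (n : ℤ) (a : ℕ) :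
    Scales s (cupFE k n a) (cupFE k n a) (s n .cupFE) :=
  ((Scales.gen .cupFE).comp (.padL _ (h.scales_dots _ a))).of_eq (mul_one _)

theorem scales_capEF (h : IsRescaling χ χ' s) (n : ℤ) (a : ℕ) :
    Scales s (capEF k n a) (capEF k n a) (s n .capEF) :=
  (Scales.comp (.padR _ _ (h.scales_dots _ a)) (.gen .capEF)).of_eq (one_mul _)

theorem scales_capFE (h : IsRescaling χ χ' s) (n : ℤ) (a : ℕ) :
    Scales s (capFE k n a) (capFE k n a) (s n .capFE) :=
  (Scales.comp (.padL _ (h.scales_dots _ a)) (.gen .capFE)).of_eq (one_mul _)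

theorem scales_cwReal (h : IsRescaling χ χ' s) (n : ℤ) (a : ℕ) :
    Scales s (cwReal k n a) (cwReal k n a) (s n .cupEF * s n .capEF) :=
  (h.scales_cupEF n a).comp (.gen _)

theorem scales_ccwReal (h : IsRescaling χ χ' s) (n : ℤ) (a : ℕ) :
    Scales s (ccwReal k n a) (ccwReal k n a) (s n .cupFE * s n .capFE) :=
  (h.scales_cupFE n a).comp (.gen _)

/-- Fake bubbles acquire the same factor as real ones, although they are defined through bubbles of
the opposite orientation and through parameters that differ between `χ` and `χ'`. -/
theorem scales_cw (h : IsRescaling χ χ' s) (n : ℤ) (j : ℕ) :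
    Scales s (cw χ n j) (cw χ' n j) (s n .cupEF * s n .capEF) := by
  unfold cw
  split_ifs with h1 h2
  -- Fake case: with p and q the clockwise and counterclockwise factors, the sum contributes 1/q.
  -- Since β' = p q β, one has (1/β)(1/q) = p (1/β'), so the total factor is p. The sign is moved
  -- into the unit so that `Scales.smul` applies.
  · simp only [← Units.val_neg]
    refine (Scales.fakeSum (fun i => h.scales_ccwReal n _) (h.ccw_cm n h1.1.le) j).smul ?_
    rw [← h.β n, mul_neg, neg_mul, mul_inv (_ * _), mul_inv (_ * _) (_ * _), mul_assoc (_)⁻¹,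
      mul_inv_cancel_left, mul_comm]
  -- The fake bubble of degree zero in region 0 is a constant; this is why `cw_cp` is required at n
  -- = 0 as well.
  · obtain ⟨rfl, rfl⟩ := h2
    exact (Scales.id _).smul (by rw [mul_one, h.cw_cp 0 le_rfl])
  · exact h.scales_cwReal _ _

/-- Mirror image of `scales_cw`: the roles of p and q are exchanged, and their product in β' is
symmetric. -/
theorem scales_ccw (h : IsRescaling χ χ' s) (n : ℤ) (j : ℕ) :
    Scales s (ccw χ n j) (ccw χ' n j) (s n .cupFE * s n .capFE) := by
  unfold ccw
  split_ifs with h1 h2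
  · simp only [← Units.val_neg]
    refine (Scales.fakeSum (fun i => h.scales_cwReal n _) (h.cw_cp n h1.1.le) j).smul ?_
    rw [← h.β n, mul_neg, neg_mul, mul_comm (s n .cupEF * s n .capEF),
      mul_inv (_ * _), mul_inv (_ * _) (_ * _), mul_assoc (_)⁻¹,
      mul_inv_cancel_left, mul_comm]
  · obtain ⟨rfl, rfl⟩ := h2
    exact (Scales.id _).smul (by rw [mul_one, h.ccw_cm 0 le_rfl])
  · exact h.scales_ccwReal _ _

theorem scales_sideEF (h : IsRescaling χ χ' s) (n : ℤ) :
    Scales s (sideEF k n) (sideEF k n) (s n .cupFE * s n .capEF) := by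
  -- The cup on the far left sees the strands EF on its right, so the label of its region is n only
  -- after this simplification.
  have hn : n + wt [E, F] = n := by simp [wt]
  refine Scales.of_eq (.comp (.comp (.padR _ _ (.gen _))
    (.padL _ (.padR _ _ (scales_gen_one (h.crossUp _))))) (.padL _ (.gen _))) ?_
  rw [hn, mul_one]

theorem scales_sideFE (h : IsRescaling χ χ' s) (n : ℤ) :
    Scales s (sideFE k n) (sideFE k n) (s n .cupEF * s n .capFE) := by
  have hn : n + wt [E, F] = n := by simp [wt]
  refine Scales.of_eq (.comp (.comp (.padL _ (.gen _))
    (.padL _ (.padR _ _ (scales_gen_one (h.crossUp _))))) (.padR _ _ (.gen _))) ?_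
  rw [hn, mul_one]

theorem scales_dotL (h : IsRescaling χ χ' s) (n : ℤ) : Scales s (dotL k n) (dotL k n) 1 :=
  .padR _ _ (scales_gen_one (h.dotUp _))

theorem scales_dotR (h : IsRescaling χ χ' s) (n : ℤ) : Scales s (dotR k n) (dotR k n) 1 :=
  .padL _ (scales_gen_one (h.dotUp _))

/-- For each relation the two sides are shown to have equal factors: 1 for zigzags, cyclicity,
nilHecke relations and the decompositions of EF and FE, and the factor of a bubble for the bubble
and curl relations. -/
theorem inIdeal_of_rel (h : IsRescaling χ χ' s) {n : ℤ} {w w' : Word} {x y : Lin k n w w'}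
    (hr : Rel k χ x y) : InIdeal χ' (Lin.scale s x - Lin.scale s y) := by
  -- Region labels appear as sums with `wt` of a word, so the cancellation conditions are restated
  -- for any m equal to n + 2.
  have hEF : ∀ n m, n + 2 = m → s m .cupEF * s n .capFE = 1 := by
    rintro n _ rfl; exact h.cupEF_capFE n
  have hFE : ∀ n m, n + 2 = m → s n .cupFE * s m .capEF = 1 := by
    rintro n _ rfl; exact h.cupFE_capEF n
  have hX : ∀ n, Scales s (Lin.gen k n .crossUp) (Lin.gen k n .crossUp) 1 :=
    fun n => scales_gen_one (h.crossUp n)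
  have hd : ∀ n, Scales s (Lin.gen k n .dotUp) (Lin.gen k n .dotUp) 1 :=
    fun n => scales_gen_one (h.dotUp n)
  cases hr with
  | zigzagE n =>
    exact Scales.inIdeal (.comp (.padR _ _ (.gen _)) (.padL _ (.gen _))) (.id _)
      (hEF _ _ (by simp [wt])) (.zigzagE n)
  | zigzagF n =>
    exact Scales.inIdeal (.comp (.padR _ _ (.gen _)) (.padL _ (.gen _))) (.id _)
      (hFE _ _ (by simp [wt])) (.zigzagF n)
  | zagzigE n =>
    exact Scales.inIdeal (.comp (.padL _ (.gen _)) (.padR _ _ (.gen _))) (.id _)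
      (hFE _ _ (by simp [wt])) (.zagzigE n)
  | zagzigF n =>
    exact Scales.inIdeal (.comp (.padL _ (.gen _)) (.padR _ _ (.gen _))) (.id _)
      (hEF _ _ (by simp [wt])) (.zagzigF n)
  | dot_right n =>
    refine Scales.inIdeal (.comp (.comp (.padL _ (.gen _)) (.padL _ (.padR _ _ (hd _))))
      (.padR _ _ (.gen _))) (scales_gen_one (h.dotDown n)) ?_ (.dot_right n)
    rw [mul_one, hEF _ _ (by simp [wt])]
  | dot_left n =>
    refine Scales.inIdeal (.comp (.comp (.padR _ _ (.gen _)) (.padL _ (.padR _ _ (hd _))))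
      (.padL _ (.gen _))) (scales_gen_one (h.dotDown n)) ?_ (.dot_left n)
    rw [mul_one, hFE _ _ (by simp [wt])]
  | cross_right n =>
    refine Scales.inIdeal (.comp (.comp (.comp (.comp (.padL _ (.gen _))
      (.padL _ (.padR _ _ (.gen _)))) (.padL _ (.padR _ _ (hX _))))
      (.padL _ (.padR _ _ (.gen _)))) (.padR _ _ (.gen _)))
      (scales_gen_one (h.crossDown n)) ?_ (.cross_right n)
    -- Nested arcs: the cup of each strand is paired with the cap of the same strand, in regions two
    -- apart, and each pair cancels.
    rw [mul_one, mul_assoc, mul_mul_mul_comm, hEF _ n (by simp [wt]),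
      hEF _ (n + wt [F]) (by simp [wt]; ring), one_mul]
  | cross_left n =>
    refine Scales.inIdeal (.comp (.comp (.comp (.comp (.padR _ _ (.gen _))
      (.padL _ (.padR _ _ (.gen _)))) (.padL _ (.padR _ _ (hX _))))
      (.padL _ (.padR _ _ (.gen _)))) (.padL _ (.gen _)))
      (scales_gen_one (h.crossDown n)) ?_ (.cross_left n)
    rw [mul_one, mul_assoc, mul_mul_mul_comm, hFE _ (n + wt [F]) (by simp [wt]; ring),
      hFE _ n (by simp [wt]), one_mul]
  | cross_cross n =>
    -- Zero scales by any factor, so the right-hand side imposes no condition; the same applies to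
    -- the bubbles of negative degree.
    exact Scales.inIdeal ((hX n).comp (hX n)) (.zero _ _ _) rfl (.cross_cross n)
  | braid n =>
    exact Scales.inIdeal
      (.comp (.comp (.padR _ _ (hX _)) (.padL _ (hX _))) (.padR _ _ (hX _)))
      (.comp (.comp (.padL _ (hX _)) (.padR _ _ (hX _))) (.padL _ (hX _))) rfl (.braid n)
  | dot_slide n =>
    exact Scales.inIdeal (.sub (.comp (h.scales_dotL n) (hX n)) (.comp (hX n) (h.scales_dotR n)))
      (.id _) (one_mul _) (.dot_slide n)
  | dot_slide' n =>
    exact Scales.inIdeal (.sub (.comp (hX n) (h.scales_dotL n)) (.comp (h.scales_dotR n) (hX n)))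
      (.id _) (one_mul _) (.dot_slide' n)
  | cw_neg n a ha =>
    exact Scales.inIdeal (h.scales_cwReal n a) (.zero _ _ _) rfl (.cw_neg n a ha)
  | ccw_neg n a ha =>
    exact Scales.inIdeal (h.scales_ccwReal n a) (.zero _ _ _) rfl (.ccw_neg n a ha)
  | cw_zero n hn =>
    exact Scales.inIdeal (h.scales_cwReal n _)
      ((Scales.id _).smul (by rw [mul_one, h.cw_cp n (by omega)])) rfl (.cw_zero n hn)
  | ccw_zero n hn =>
    exact Scales.inIdeal (h.scales_ccwReal n _)
      ((Scales.id _).smul (by rw [mul_one, h.ccw_cm n (by omega)])) rfl (.ccw_zero n hn)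
  | curl_right n =>
    refine Scales.inIdeal (.comp (.comp (.padL _ (.gen _)) (.padR _ _ (hX _))) (.padL _ (.gen _)))
      (.neg (.sum fun f => .comp (h.scales_dots n _) (.padL _ (h.scales_cw n _)))) ?_
      (.curl_right n)
    -- The curl contains one cup and one cap in region n, the same pair as the bubble that replaces
    -- it.
    rw [mul_one, one_mul]
  | curl_left m _ hn =>
    refine Scales.inIdeal (.comp (.comp (.padR _ _ (.gen _)) (.padL _ (hX _)))
      (.padR _ _ (.gen _)))
      (.sum fun f => .comp (h.scales_dots _ _) (.padR _ _ (h.scales_ccw m _))) ?_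
      (.curl_left m _ hn)
    rw [mul_one, one_mul]
  | ident_EF n =>
    -- Both correction terms have factor p q: the product of sideways crossings uses all four cups
    -- and caps in region n once, while the other term has the cup and cap of p together with a
    -- counterclockwise bubble. The condition on β then makes the total factor 1.
    refine Scales.inIdeal (.id _) (.sub ((Scales.comp (h.scales_sideEF n) (h.scales_sideFE n)).smul
      ?_) ((Scales.sum fun f => .comp (.comp (h.scales_capEF n _) (h.scales_ccw n _))
        (h.scales_cupEF n _)).smul ?_)) rfl (.ident_EF n)
    · rw [← h.β n, one_mul]
      ac_rfl
    · rw [← h.β n, one_mul]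
      ac_rfl
  | ident_FE n =>
    -- The same count with orientations exchanged: the outer cup and cap give q, and the inner
    -- clockwise bubble gives p.
    refine Scales.inIdeal (.id _) (.sub ((Scales.comp (h.scales_sideFE n) (h.scales_sideEF n)).smul
      ?_) ((Scales.sum fun f => .comp (.comp (h.scales_capFE n _) (h.scales_cw n _))
        (h.scales_cupFE n _)).smul ?_)) rfl (.ident_FE n)
    · rw [← h.β n, one_mul]
      ac_rfl
    · rw [← h.β n, one_mul]
      ac_rfl

theorem inIdeal_scale (h : IsRescaling χ χ' s) {n : ℤ} {w w' : Word} {x : Lin k n w w'}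
    (hx : InIdeal χ x) : InIdeal χ' (Lin.scale s x) := by
  induction hx with
  | rel hr => rw [map_sub]; exact h.inIdeal_of_rel hr
  | zero n w w' => rw [map_zero]; exact .zero n w w'
  | add _ _ hx hy => rw [map_add]; exact .add hx hy
  | smul a _ hx => rw [map_smul]; exact .smul a hx
  | comp_left y _ hx => rw [Lin.scale_comp]; exact .comp_left _ hx
  | comp_right x _ hy => rw [Lin.scale_comp]; exact .comp_right _ hy
  | padL u _ hx => rw [Lin.scale_padL]; exact .padL u hx
  | padR v hm _ hx => rw [Lin.scale_padR]; exact .padR v hm hx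

end IsRescaling
end Rescaling

/-! ### The strict 2-functor defined by a rescaling, and its inverse -/

section Functor
variable {k : Type*} [Field k] {χ χ' : Params k} {s : GenScale k}

namespace Two
variable {m n : ℤ}

/-- Rescaling of diagrams modulo the relations. -/
def scale (h : IsRescaling χ χ' s) {w w' : Word} : Two χ n w w' →ₗ[k] Two χ' n w w' :=
  (ideal χ n w w').mapQ _ (Lin.scale s) fun _ hx => h.inIdeal_scale hx

variable (h : IsRescaling χ χ' s)

theorem scale_ofLin {w w' : Word} (x : Lin k n w w') :
    scale h (ofLin χ x) = ofLin χ' (Lin.scale s x) := rfl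

@[simp] theorem scale_diag {w w' : Word} (D : Diag n w w') :
    scale h (diag χ D) = (D.scale s).val • diag χ' D := by
  rw [diag, scale_ofLin, Lin.scale_single, one_mul, diag, ← map_smul, Finsupp.smul_single',
    mul_one]

theorem scale_id (w : Word) : scale h (id χ n w) = id χ' n w :=
  congrArg (ofLin χ') (Lin.scale_id s w)

theorem scale_comp {w w' w'' : Word} (x : Two χ n w w') (y : Two χ n w' w'') :
    scale h (comp x y) = comp (scale h x) (scale h y) := by
  induction x using Submodule.Quotient.induction_on with
  | _ x =>
    induction y using Submodule.Quotient.induction_on with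
    | _ y => exact congrArg (ofLin χ') (Lin.scale_comp s x y)

theorem scale_padL (u : Word) {w w' : Word} (x : Two χ n w w') :
    scale h (padL u x) = padL u (scale h x) := by
  induction x using Submodule.Quotient.induction_on with
  | _ x => exact congrArg (ofLin χ') (Lin.scale_padL s u x)

theorem scale_padR (v : Word) (hm : m = n + wt v) {w w' : Word} (x : Two χ m w w') :
    scale h (padR v hm x) = padR v hm (scale h x) := by
  induction x using Submodule.Quotient.induction_on with
  | _ x => exact congrArg (ofLin χ') (Lin.scale_padR s v hm x)

theorem scale_inv_scale {w w' : Word} (x : Two χ n w w') :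
    scale h.inv (scale h x) = x := by
  induction x using Submodule.Quotient.induction_on with
  | _ x => exact congrArg (ofLin χ) (Lin.scale_inv_scale s x)

/-- Each diagram is only multiplied by a scalar, so spans of diagrams of a given degree are
preserved. -/
theorem scale_mem {w w' : Word} {x : Two χ n w w'} {d : ℤ} (hx : x ∈ homog χ n w w' d) :
    scale h x ∈ homog χ' n w w' d := by
  induction hx using Submodule.span_induction with
  | mem x hx =>
    obtain ⟨D, hD, rfl⟩ := hx
    rw [scale_diag]
    exact Submodule.smul_mem _ _ (diag_mem D hD)
  | zero => rw [map_zero]; exact Submodule.zero_mem _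
  | add x y _ _ hx hy => rw [map_add]; exact Submodule.add_mem _ hx hy
  | smul a x _ hx => rw [map_smul]; exact Submodule.smul_mem _ _ hx

theorem scale_ofLin_of_scales {w w' : Word} {x x' : Lin k n w w'} {c : kˣ}
    (hx : Scales s x x' c) : scale h (ofLin χ x) = c.val • ofLin χ' x' := by
  rw [scale_ofLin, hx, map_smul]

end Two

namespace IsRescaling

/-- The strict 2-functor that rescales the generators. -/
def functor (h : IsRescaling χ χ' s) : FunctorOverId χ χ' where
  map₂ {m _ f g} := (Two.scale (n := m) h).restrict (p := Two.homog χ m f.word g.word _)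
    (q := Two.homog χ' m f.word g.word _) fun _ hx => Two.scale_mem h hx
  map₂_id f := Subtype.ext (Two.scale_id h f.word)
  map₂_comp x y := Subtype.ext (Two.scale_comp h x.1 y.1)
  map₂_whiskerLeft f _ _ x := Subtype.ext (Two.scale_padR h f.word f.weight x.1)
  map₂_whiskerRight x g := Subtype.ext (Two.scale_padL h g.word x.1)

theorem inv_functor_map₂ (h : IsRescaling χ χ' s) {m n : ℤ} {f g : Mor χ m n} (x : f ⟶ g) :
    h.inv.functor.map₂ (h.functor.map₂ x) = x :=
  Subtype.ext (Two.scale_inv_scale h x.1)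

/-- Here the scalars of the second rescaling, inverted twice, have to be identified with `s`. -/
theorem functor_inv_map₂ (h : IsRescaling χ χ' s) {m n : ℤ} {f g : Mor χ' m n} (x : f ⟶ g) :
    h.functor.map₂ (h.inv.functor.map₂ x) = x :=
  Subtype.ext (by
    obtain ⟨x, hx⟩ := x
    induction x using Submodule.Quotient.induction_on with
    | _ x =>
      refine (congrArg (fun t => Two.ofLin χ' (Lin.scale t _)) ?_).trans
        (congrArg (Two.ofLin χ') (Lin.scale_inv_scale (fun n _ _ g => (s n g)⁻¹) x))
      funext n w w' g
      exact (inv_inv _).symm)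

/-- Transfers a factor computed for linear combinations of diagrams to 2-morphisms. The
representatives `x` and `x'` may differ, as fake bubbles do for different parameters. -/
theorem functor_map₂_ofTwo (h : IsRescaling χ χ' s) {m n : ℤ} {f g : Mor χ m n}
    {x x' : Lin k m f.word g.word} {d : ℤ} {c : kˣ} (hs : Scales s x x' c)
    (hx : Two.ofLin χ x ∈ Two.homog χ m f.word g.word d)
    (hx' : Two.ofLin χ' x' ∈ Two.homog χ' m f.word g.word d) (hd : d = f.shift - g.shift) :
    h.functor.map₂ (Mor.ofTwo χ (Two.ofLin χ x) hx hd) =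
      c.val • Mor.ofTwo χ' (f := f.conv χ') (g := g.conv χ') (Two.ofLin χ' x') hx' hd :=
  Subtype.ext (Two.scale_ofLin_of_scales h hs)

end IsRescaling
end Functor

/-! ### Equality of strict 2-functors -/

section Strict
variable {B : Type*} [Bicategory B] {C : Type*} [Bicategory C]

/-- Strictness forces the unit and composition isomorphisms to be those given by equalities, so they
carry no extra data. -/
theorem strictPseudofunctor_ext {F G : StrictPseudofunctor B C}
    (h : F.toPrelaxFunctor = G.toPrelaxFunctor) : F = G := by
  obtain ⟨⟨⟨F, Fi, Fc, _, _, _, _, _⟩, hFi, hFi'⟩, hFc, hFc'⟩ := F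
  obtain ⟨⟨⟨G, Gi, Gc, _, _, _, _, _⟩, hGi, hGi'⟩, hGc, hGc'⟩ := G
  obtain rfl : F = G := h
  obtain rfl : @Fi = @Gi := funext fun a => (hFi' a).trans (hGi' a).symm
  obtain rfl : @Fc = @Gc := by
    funext a b c f g
    exact (hFc' f g).trans (hGc' f g).symm
  rfl

theorem prelaxFunctor_ext {F G : PrelaxFunctor B C} (h : F.toPrefunctor = G.toPrefunctor)
    (h₂ : @F.map₂ ≍ @G.map₂) : F = G := by
  obtain ⟨⟨F, F₂⟩, _, _⟩ := F
  obtain ⟨⟨G, G₂⟩, _, _⟩ := G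
  obtain rfl : F = G := h
  obtain rfl := eq_of_heq h₂
  rfl

variable {k : Type*} [Field k] {χ χ' : Params k}

/-- Changing the parameters of a direct sum of 1-morphisms and changing them back is definitionally
the identity, so only the entries of matrices of 2-morphisms have to be compared. -/
theorem FunctorOverId.comp_eq_id (M : FunctorOverId χ χ') (N : FunctorOverId χ' χ)
    (h : ∀ {m n : ℤ} {f g : Mor χ m n} (x : f ⟶ g), N.map₂ (M.map₂ x) = x) :
    M.toStrictPseudofunctor.comp N.toStrictPseudofunctor = StrictPseudofunctor.id (U χ) := by
  refine strictPseudofunctor_ext (prelaxFunctor_ext rfl (heq_of_eq ?_))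
  funext a b F G x
  exact Mat_.hom_ext _ _ fun i j => h (x i j)

end Strict

/-! ### The prescribed factors satisfy the conditions -/

section Main
variable {k : Type*} [Field k] (χ : Params k)

/-- The residues modulo 4 that rescale this cup in region n + 2 are those that rescale this cap in
region n, with inverse values. In the crossing regions n = -1 and n = -2 both factors are 1, so no
constraint on `χ` is needed. -/
theorem cupEFFactor_mul_capFEFactor (n : ℤ) : cupEFFactor χ (n + 2) * capFEFactor χ n = 1 := by
  unfold cupEFFactor capFEFactor
  split_ifs <;> first | (exfalso; omega) | simp

namespace Params.Consistent
variable {χ}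

theorem cp_two (hχ : χ.Consistent) : χ.cp 2 = (χ.cm 0)⁻¹ := by
  rw [eq_inv_iff_mul_eq_one, ← hχ.zero, show (2 : ℤ) = 0 + 2 by norm_num, hχ.plus 0 le_rfl]
  simp only [neg_mul, neg_inj]
  ac_rfl

theorem cm_neg_two (hχ : χ.Consistent) : χ.cm (-2) = (χ.cp 0)⁻¹ := by
  rw [eq_inv_iff_mul_eq_one, ← hχ.zero, show (-2 : ℤ) = 0 - 2 by norm_num, hχ.minus 0 le_rfl]
  simp only [neg_mul, neg_inj]
  ac_rfl

/-- Away from n = -1 and n = -2 the two factors are visibly inverse. At those two values the cup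
carries c^- and the cap carries c^+, and the conditions relating c^+ to c^- enter. -/
theorem cupFE_mul_capEF (hχ : χ.Consistent) (n : ℤ) : cupFEFactor χ n * capEFFactor χ (n + 2) = 1 := by
  obtain rfl | rfl | hn : n = -1 ∨ n = -2 ∨ n ≠ -1 ∧ n ≠ -2 := by omega
  · simp [cupFEFactor, capEFFactor, hχ.one]
  · simp [cupFEFactor, capEFFactor, hχ.cm_neg_two]
  unfold cupFEFactor capEFFactor
  split_ifs <;> first | (exfalso; omega) | simp

/-- By the pattern modulo 4 one of the two factors is 1 and the other is the full bubble factor; for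
n < 0 the recursion rewrites c_{n-2}^- as -β_n c_n^-. -/
theorem cupEF_mul_capEF (hχ : χ.Consistent) (n : ℤ) : cupEFFactor χ n * capEFFactor χ n = cwFactor χ n := by
  unfold cupEFFactor capEFFactor cwFactor
  split_ifs <;> first | (exfalso; omega) | simp [hχ.minus n (by omega)] | simp

theorem cupFE_mul_capFE (hχ : χ.Consistent) (n : ℤ) : cupFEFactor χ n * capFEFactor χ n = ccwFactor χ n := by
  -- In region 0 the factor is written with c_2^+, whereas `ccwFactor` uses c_0^-; `cp_two`
  -- reconciles the two descriptions.
  by_cases hn : n = 0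
  · subst hn
    simp [cupFEFactor, capFEFactor, ccwFactor, hχ.cp_two]
  unfold cupFEFactor capFEFactor ccwFactor
  split_ifs <;> first | (exfalso; omega) | simp [hχ.plus n (by omega)] | simp

theorem isRescaling_rescale (hχ : χ.Consistent) : IsRescaling (Params.standard k) χ (fun n _ _ g => rescale χ n g) where
  dotUp _ := rfl
  dotDown _ := rfl
  crossUp _ := rfl
  crossDown _ := rfl
  cupEF_capFE := cupEFFactor_mul_capFEFactor χ
  cupFE_capEF := hχ.cupFE_mul_capEF
  cw_cp n hn := by
    refine (congrArg (· * _) (hχ.cupEF_mul_capEF n)).trans ?_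
    simp [cwFactor, hn, Params.standard, Params.cp]
  ccw_cm n hn := by
    refine (congrArg (· * _) (hχ.cupFE_mul_capFE n)).trans ?_
    simp [ccwFactor, hn, Params.standard, Params.cm]
  β n := by
    refine (congrArg (· * _) (congrArg₂ (· * ·) (hχ.cupEF_mul_capEF n)
      (hχ.cupFE_mul_capFE n))).trans ?_
    -- The value -1 is the standard β. For n ≠ 0 one bubble factor is 1/c and the other is -β c with
    -- the same c, so their product is -β; for n = 0 the product is 1/(c_0^+ c_0^-), which equals -β
    -- by the normalization at zero.
    change _ * -1 = _
    obtain hn | rfl | hn := lt_trichotomy n 0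
    · simp [cwFactor, ccwFactor, hn.le, not_le.2 hn]
    · have := hχ.zero
      simp only [cwFactor, ccwFactor, le_refl, if_true]
      rw [← mul_inv, mul_neg, mul_one, neg_eq_iff_eq_neg, inv_eq_iff_mul_eq_one, ← this, mul_neg]
    · simp [cwFactor, ccwFactor, hn.le, not_le.2 hn, mul_comm (χ.β n)]

end Params.Consistent
end Main
end CatSl2
end

theorem mainTheorem3 {k : Type*} [Field k] (χ : CatSl2.Params k) (hχ : χ.Consistent) :
    ∃ M : CatSl2.FunctorOverId (CatSl2.Params.standard k) χ,
      (∃ N : StrictPseudofunctor (CatSl2.U χ) (CatSl2.U (CatSl2.Params.standard k)),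
        M.toStrictPseudofunctor.comp N =
          StrictPseudofunctor.id (CatSl2.U (CatSl2.Params.standard k)) ∧
        N.comp M.toStrictPseudofunctor = StrictPseudofunctor.id (CatSl2.U χ)) ∧
      (∀ (n t : ℤ) (w w' : CatSl2.Word) (g : CatSl2.Gen w w'),
        M.map₂ (CatSl2.genMor (CatSl2.Params.standard k) n t g) =
          (CatSl2.rescale χ n g : k) • CatSl2.genMor χ n t g) ∧
      (∀ (n t : ℤ) (j : ℕ),
        M.map₂ (CatSl2.cwMor (CatSl2.Params.standard k) n t j) =
          (CatSl2.cwFactor χ n : k) • CatSl2.cwMor χ n t j) ∧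
      (∀ (n t : ℤ) (j : ℕ),
        M.map₂ (CatSl2.ccwMor (CatSl2.Params.standard k) n t j) =
          (CatSl2.ccwFactor χ n : k) • CatSl2.ccwMor χ n t j) := by
  have h := hχ.isRescaling_rescale
  -- The inverse 2-functor is the rescaling by the inverse units.
  refine ⟨h.functor, ⟨h.inv.functor.toStrictPseudofunctor,
    CatSl2.FunctorOverId.comp_eq_id _ _ h.inv_functor_map₂,
    CatSl2.FunctorOverId.comp_eq_id _ _ h.functor_inv_map₂⟩,
    fun n t w w' g => ?_, fun n t j => ?_, fun n t j => ?_⟩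
  · exact h.functor_map₂_ofTwo (.gen g) _ (CatSl2.Two.ofLin_gen_mem χ n g) _
  · exact h.functor_map₂_ofTwo ((h.scales_cw n j).of_eq (hχ.cupEF_mul_capEF n)) _
      (CatSl2.Two.cw_mem χ n j) _
  · exact h.functor_map₂_ofTwo ((h.scales_ccw n j).of_eq (hχ.cupFE_mul_capFE n)) _
      (CatSl2.Two.ccw_mem χ n j) _
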